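/- Let $G$ be the Cantor dyadic group: the group of sequences $x=(x_j)_{j\in\mathbb Z}$ with $x_j\in\{0,1\}$ and $x_j=0$ for all $j<k(x)$, under coordinatewise addition mod $2$, with the topology in which the subgroups $U_l=\{x: x_j=0 \text{ for } j\le l\}$, $l\in\mathbb Z$, form a neighbourhood basis of $0$. Let $D=U_0$, let $\Lambda=\{x\in G: x_j=0\text{ for } j>0\}$, let $\rho$ be the automorphism $(\rho x)_j=x_{j+1}$, $\sigma=\rho^{-1}$, $\Lambda_1=\rho(\Lambda)$, and let $0.1\in G$ be the element whose only nonzero coordinate is the one with index $1$. Let $|\cdot|$ be the Haar measure on $G$ with $|D|=1$; identify the dual group of $G$ with $G$ through $\chi(x,\omega)=(-1)^{\sum_j x_j\omega_{1-j}}$, let $\hat f$ be the Fourier transform of $f\in L^2(G)$, given by $\hat f(\omega)=\int_G f(x)\overline{\chi(x,\omega)}\,dx$ for $f \in L^1(G)\cap L^2(G)$, and let $T_nf(x)=f(x-n)$. Let $(V_j)_{j\in\mathbb Z}$ be a frame multiresolution analysis of $L^2(G)$ with scaling function $\phi$; that is, the $V_j$ are closed subspaces of $L^2(G)$ with $V_j\subseteq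 V_{j+1}$, with $f\in V_j\iff f(\rho\,\cdot)\in V_{j+1}$, with $\overline{\bigcup_j V_j}=L^2(G)$ and $\bigcap_j V_j=\{0\}$, and $\phi\in V_0$ is such that $\{T_n\phi:n\in\Lambda\}$ is a frame for $V_0$, with frame bounds $0<\mathcal C\le\mathcal D<\infty$. Let $m$ be a $\Lambda$-periodic function, square integrable on $D$, with $\hat\phi(\rho\omega)=m(\omega)\hat\phi(\omega)$ for a.e. $\omega$. Put $$\Delta_2=\Big\{\omega\in D:\ \sum_{n\in\Lambda_1}|\hat\phi(\sigma(\omega+n))|^2\ne0\ \text{ and }\ \sum_{n\in\Lambda\setminus\Lambda_1}|\hat\phi(\sigma(\omega+n))|^2\neq0\Big\}$$ and $E=\{\omega\in\Delta_2: m(\sigma\omega)=m(\sigma\omega+0.1)=0\}$. If $|E|=0$, then for a.e. $\omega\in\Delta_2$, $$\frac{\mathcal C}{\mathcal D}\le |m(\sigma\omega)|^2+|m(\sigma\omega+0.1)|^2\le\frac{\mathcal D}{\mathcal C}.$$ -/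

import Mathlib

open MeasureTheory Filter Topology
open scoped ENNReal

noncomputable section

namespace CantorDyadic

/-- Two-sided binary sequences `(x_j)`, `j : ℤ`, that vanish for all sufficiently negative `j`,
under coordinatewise addition modulo `2`. -/
def seqSubgroup : AddSubgroup (ℤ → ZMod 2) where
  carrier := {x | ∃ k : ℤ, ∀ j < k, x j = 0}
  zero_mem' := ⟨0, fun _ _ => rfl⟩
  add_mem' := by
    rintro x y ⟨k, hk⟩ ⟨l, hl⟩
    refine ⟨min k l, fun j hj => ?_⟩
    rw [Pi.add_apply, hk j (lt_of_lt_of_le hj (min_le_left _ _)),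
      hl j (lt_of_lt_of_le hj (min_le_right _ _)), add_zero]
  neg_mem' := by
    rintro x ⟨k, hk⟩
    exact ⟨k, fun j hj => by rw [Pi.neg_apply, hk j hj, neg_zero]⟩

/-- The Cantor dyadic group `G`. It is a type of its own, so that it does not inherit the (coarser)
topology of the product `ℤ → ZMod 2`. The dual group is identified with `G` through `chi`. -/
def G : Type := seqSubgroup

instance : AddCommGroup G := inferInstanceAs (AddCommGroup seqSubgroup)

instance : CoeFun G (fun _ => ℤ → ZMod 2) := ⟨fun x => x.1⟩

/-- The element of `G` with the given coordinates. -/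
def G.mk (x : ℤ → ZMod 2) (hx : ∃ k : ℤ, ∀ j < k, x j = 0) : G := ⟨x, hx⟩

@[simp] theorem G.mk_apply (x : ℤ → ZMod 2) (hx : ∃ k : ℤ, ∀ j < k, x j = 0) (j : ℤ) :
    G.mk x hx j = x j := rfl

@[ext] theorem G.ext {x y : G} (h : ∀ j, x j = y j) : x = y := Subtype.ext (funext h)

@[simp] theorem add_apply (x y : G) (j : ℤ) : (x + y) j = x j + y j := rfl
@[simp] theorem neg_apply (x : G) (j : ℤ) : (-x) j = -(x j) := rfl
@[simp] theorem zero_apply (j : ℤ) : (0 : G) j = 0 := rfl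

/-- The subgroups `U_l = {x : x_j = 0 for j ≤ l}`. -/
def U (l : ℤ) : AddSubgroup G where
  carrier := {x | ∀ j ≤ l, x j = 0}
  zero_mem' := fun _ _ => rfl
  add_mem' := fun {x y} hx hy j hj => by rw [add_apply, hx j hj, hy j hj, add_zero]
  neg_mem' := fun {x} hx j hj => by rw [neg_apply, hx j hj, neg_zero]

theorem mem_U {l : ℤ} {x : G} : x ∈ U l ↔ ∀ j ≤ l, x j = 0 := Iff.rfl

/-- The sets `U_l` form a neighbourhood basis of zero. -/
@[reducible] def basis : AddGroupFilterBasis G where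
  sets := Set.range (fun l : ℤ => (U l : Set G))
  nonempty := ⟨_, 0, rfl⟩
  inter_sets := by
    rintro _ _ ⟨k, rfl⟩ ⟨l, rfl⟩
    exact ⟨_, ⟨max k l, rfl⟩, fun x hx =>
      ⟨fun j hj => hx j (hj.trans (le_max_left _ _)), fun j hj => hx j (hj.trans (le_max_right _ _))⟩⟩
  zero' := by
    rintro _ ⟨l, rfl⟩
    exact (U l).zero_mem
  add' := by
    rintro _ ⟨l, rfl⟩
    refine ⟨_, ⟨l, rfl⟩, ?_⟩
    rintro _ ⟨x, hx, y, hy, rfl⟩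
    exact (U l).add_mem hx hy
  neg' := by
    rintro _ ⟨l, rfl⟩
    exact ⟨_, ⟨l, rfl⟩, fun x hx => (U l).neg_mem hx⟩
  conj' := by
    rintro x _ ⟨l, rfl⟩
    refine ⟨_, ⟨l, rfl⟩, fun y hy => ?_⟩
    simpa using hy

instance : TopologicalSpace G := basis.topology

instance : IsTopologicalAddGroup G := basis.isTopologicalAddGroup

theorem U_mem_nhds_zero (l : ℤ) : (U l : Set G) ∈ 𝓝 (0 : G) :=
  basis.mem_nhds_zero ⟨l, rfl⟩

/-- The element `0.c₀c₁c₂…` of `G`. -/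
def ofDigits (c : ℕ → ZMod 2) : G :=
  G.mk (fun j => if 0 < j then c (j - 1).toNat else 0) ⟨0, fun j hj => if_neg (by omega)⟩

theorem ofDigits_apply (c : ℕ → ZMod 2) (j : ℤ) :
    ofDigits c j = if 0 < j then c (j - 1).toNat else 0 := rfl

theorem continuous_ofDigits : Continuous ofDigits := by
  rw [continuous_iff_continuousAt]
  intro c
  rw [ContinuousAt, (basis.nhds_hasBasis (ofDigits c)).tendsto_right_iff]
  rintro _ ⟨l, rfl⟩
  have h : ∀ᶠ d in 𝓝 c, ∀ i ∈ Finset.range l.toNat, d i = c i := by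
    rw [Filter.eventually_all_finset]
    intro i _
    have hi : Continuous fun d : ℕ → ZMod 2 => d i := continuous_apply i
    exact hi.continuousAt.eventually (p := fun a => a = c i)
      (by rw [nhds_discrete]; exact Filter.eventually_pure.2 rfl)
  filter_upwards [h] with d hd
  refine ⟨ofDigits d - ofDigits c, fun j hj => ?_, add_sub_cancel _ _⟩
  rw [sub_eq_add_neg, add_apply, neg_apply, ofDigits_apply, ofDigits_apply]
  split_ifs with h0
  · rw [hd _ (Finset.mem_range.2 (by omega)), add_neg_cancel]
  · simp

theorem isCompact_U_zero : IsCompact (U 0 : Set G) := by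
  have : (U 0 : Set G) = Set.range ofDigits := by
    ext x
    constructor
    · intro hx
      refine ⟨fun i => x (i + 1), G.ext fun j => ?_⟩
      rw [ofDigits_apply]
      split_ifs with h
      · show x _ = x j
        rw [show ((j - 1).toNat : ℤ) + 1 = j by omega]
      · exact (hx j (by omega)).symm
    · rintro ⟨c, rfl⟩ j hj
      exact if_neg (by omega)
  rw [this]
  exact isCompact_range continuous_ofDigits

/-- The set `D = U_0 = {x : x_j = 0 for j ≤ 0}` as a compact set with nonempty interior. -/
def compactD : TopologicalSpace.PositiveCompacts G where
  carrier := U 0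
  isCompact' := isCompact_U_zero
  interior_nonempty' := ⟨0, mem_interior_iff_mem_nhds.2 (U_mem_nhds_zero 0)⟩

instance : MeasurableSpace G := borel G

instance : BorelSpace G := ⟨rfl⟩

/-- The Haar measure on the Borel sets of `G` normalized so that `D` has measure one. -/
def haar : Measure G := Measure.addHaarMeasure compactD

instance : haar.IsAddHaarMeasure := inferInstanceAs (Measure.addHaarMeasure compactD).IsAddHaarMeasure

/-- `L²(G)`. -/
abbrev L2 : Type := Lp ℂ 2 haar

/-- `Λ = {x : x_j = 0 for j > 0}`, the "integers" of `G`. -/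
def Lam : AddSubgroup G where
  carrier := {x | ∀ j > 0, x j = 0}
  zero_mem' := fun _ _ => rfl
  add_mem' := fun {x y} hx hy j hj => by rw [add_apply, hx j hj, hy j hj, add_zero]
  neg_mem' := fun {x} hx j hj => by rw [neg_apply, hx j hj, neg_zero]

/-- The automorphism `ρ` of `G`, `(ρ x)_j = x_{j+1}`. -/
def rho : G ≃+ G where
  toFun x := G.mk (fun j => x (j + 1)) (by
    obtain ⟨k, hk⟩ := x.2
    exact ⟨k - 1, fun j hj => hk _ (by omega)⟩)
  invFun x := G.mk (fun j => x (j - 1)) (by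
    obtain ⟨k, hk⟩ := x.2
    exact ⟨k + 1, fun j hj => hk _ (by omega)⟩)
  left_inv x := G.ext fun j => congrArg x.1 (by omega)
  right_inv x := G.ext fun j => congrArg x.1 (by omega)
  map_add' _ _ := rfl

/-- `σ = ρ⁻¹`, `(σ x)_j = x_{j-1}`. -/
def sigma : G ≃+ G := rho.symm

/-- `Λ₁ = ρ(Λ)`, the "even integers" of `G`. -/
def Lam1 : AddSubgroup G := Lam.map rho.toAddMonoidHom

/-- The element `0.1` of `G`: its coordinate with index `1` is one, all others vanish. -/
def pointOne : G := G.mk (fun j => if j = 1 then 1 else 0) ⟨1, fun j hj => if_neg (by omega)⟩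

/-- The pairing `χ(x, ω) = (-1)^{∑_j x_j ω_{1-j}}`; only finitely many terms are nonzero. -/
def chi (x ω : G) : ℂ := (-1) ^ (∑ᶠ j : ℤ, (x j).val * (ω (1 - j)).val)

/-- `g` is (a representative of) the `L²` Fourier transform of `f ∈ L²(G)`: `g` is square integrable
and the truncated Fourier integrals `ω ↦ ∫_{U_{-N}} f(x) conj(χ(x, ω)) dx` converge to `g` in `L²`.
(The compact open subgroups `U_{-N}` increase to `G`, so `f` is integrable on each of them.) -/
def IsFourierTransform (f : L2) (g : G → ℂ) : Prop :=
  MemLp g 2 haar ∧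
    Tendsto (fun N : ℕ =>
      eLpNorm (fun ω => (∫ x in (U (-(N : ℤ)) : Set G), f x * (starRingEnd ℂ) (chi x ω) ∂haar) - g ω)
        2 haar) atTop (𝓝 0)

/-- Translation `T_y f (x) = f(x - y)` on `L²(G)`. -/
def translate (y : G) (f : L2) : L2 :=
  Lp.compMeasurePreserving (fun x => x - y) (measurePreserving_sub_right haar y) f

/-- The family `v` is a frame for the closed subspace `W` with frame bounds `C` and `D`. -/
structure IsFrameWithBounds {ι : Type*} (W : Submodule ℂ L2) (v : ι → L2) (C D : ℝ) : Prop where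
  mem : ∀ i, v i ∈ W
  lower_pos : 0 < C
  lower_le_upper : C ≤ D
  summable : ∀ f ∈ W, Summable fun i => ‖inner ℂ f (v i)‖ ^ 2
  lower : ∀ f ∈ W, C * ‖f‖ ^ 2 ≤ ∑' i, ‖inner ℂ f (v i)‖ ^ 2
  upper : ∀ f ∈ W, ∑' i, ‖inner ℂ f (v i)‖ ^ 2 ≤ D * ‖f‖ ^ 2

/-- `(V_j)` is a frame multiresolution analysis of `L²(G)` and `φ` is a scaling function of it whose
translates `T_n φ`, `n ∈ Λ`, form a frame for `V_0` with frame bounds `C` and `D`. -/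
structure IsFMRA (V : ℤ → Submodule ℂ L2) (φ : L2) (C D : ℝ) : Prop where
  closed : ∀ j, IsClosed (V j : Set L2)
  mono : ∀ j, V j ≤ V (j + 1)
  dilate : ∀ j, ∀ f g : L2, (g : G → ℂ) =ᵐ[haar] (fun x => f (rho x)) → (f ∈ V j ↔ g ∈ V (j + 1))
  dense : closure (⋃ j, (V j : Set L2)) = Set.univ
  inter : ⋂ j, (V j : Set L2) = {0}
  scaling_mem : φ ∈ V 0
  frame : IsFrameWithBounds (V 0) (fun n : Lam => translate n φ) C D

/-- `Δ₂ = {ω ∈ D : ∑_{n ∈ Λ₁} |φ̂(σ(ω+n))|² ≠ 0 and ∑_{n ∈ Λ ∖ Λ₁} |φ̂(σ(ω+n))|² ≠ 0}`. -/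
def Delta2 (φhat : G → ℂ) : Set G :=
  {ω | ω ∈ U 0 ∧
    (∑' n : ((Lam1 : Set G) : Type), ‖φhat (sigma (ω + n))‖ₑ ^ 2) ≠ 0 ∧
    (∑' n : (((Lam : Set G) \ (Lam1 : Set G) : Set G) : Type), ‖φhat (sigma (ω + n))‖ₑ ^ 2) ≠ 0}

/-- `E = {ω ∈ Δ₂ : m(σω) = m(σω + 0.1) = 0}`. -/
def exceptionalSet (φhat m : G → ℂ) : Set G :=
  {ω | ω ∈ Delta2 φhat ∧ m (sigma ω) = 0 ∧ m (sigma ω + pointOne) = 0}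

/-- `m` is a mask for `φ̂`: it is square integrable on `D`, `Λ`-periodic, and
`φ̂(ρω) = m(ω) φ̂(ω)` almost everywhere. -/
structure IsMask (φhat m : G → ℂ) : Prop where
  memLp : MemLp m 2 (haar.restrict (U 0 : Set G))
  periodic : ∀ n ∈ Lam, ∀ᵐ ω ∂haar, m (ω + n) = m ω
  refinement : ∀ᵐ ω ∂haar, φhat (rho ω) = m ω * φhat ω

end CantorDyadic

end

noncomputable section

namespace CantorDyadic

/-! ### Topology of `G` -/

/-! Let P(ω) be the sum of |φ̂(ω+n)|² over n in Λ (`periodization`). Splitting Λ into Λ₁ and its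
complement in the refinement equation gives, almost everywhere, P(ω) = |m(σω)|² P(σω) + |m(σω+0.1)|²
P(σω+0.1) (`periodization_refinement`). The frame bounds force C ≤ P ≤ D almost everywhere on D
where P ≠ 0 (`periodization_le`, `le_periodization`). On Δ₂ both values of P on the right are
nonzero, hence in [C, D]. Outside E the coefficients do not both vanish, so P(ω) > 0 and P(ω) is in
[C, D] too; dividing gives the claim (`mask_bounds`).

The bounds on P come from testing the frame inequality on functions f in the span of the translates
whose transform is φ̂ cut to a Λ-periodic cylinder (`exists_isFourierTransform_cylinder`). By
Plancherel and Parseval, ‖f‖² is the integral of P over a ball B, and the frame coefficients of f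
are the Walsh coefficients of P on B. Keeping only those n whose character is constant on B gives
the upper bound on average over B; Bessel's inequality then gives C ∫ P ≤ ∫ P² over B. Inequalities
on all balls of D pass to almost every point by `ae_le_of_setLIntegral_ball_le`. -/

theorem U_anti {k l : ℤ} (h : k ≤ l) : U l ≤ U k := fun _ hx j hj => hx j (hj.trans h)

theorem isOpen_U (l : ℤ) : IsOpen (U l : Set G) :=
  AddSubgroup.isOpen_of_mem_nhds _ (U_mem_nhds_zero l)

theorem measurableSet_U (l : ℤ) : MeasurableSet (U l : Set G) := (isOpen_U l).measurableSet

theorem nhds_zero_hasBasis : (𝓝 (0 : G)).HasBasis (fun _ : ℕ => True) fun N => (U N : Set G) := by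
  refine ⟨fun t => ?_⟩
  rw [basis.nhds_zero_hasBasis.mem_iff]
  constructor
  · rintro ⟨_, ⟨l, rfl⟩, hl⟩
    exact ⟨l.toNat, trivial, subset_trans (U_anti (by omega)) hl⟩
  · rintro ⟨N, -, hN⟩
    exact ⟨_, ⟨N, rfl⟩, hN⟩

instance : (𝓝 (0 : G)).IsCountablyGenerated :=
  nhds_zero_hasBasis.isCountablyGenerated

theorem sub_eq_add' (x y : G) : x - y = x + y := by
  ext j
  rw [sub_eq_add_neg, add_apply, add_apply, neg_apply]
  congr 1
  exact ZMod.neg_eq_self_mod_two _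

theorem add_self' (x : G) : x + x = 0 := by rw [← sub_eq_add', sub_self]

@[simp] theorem sub_apply (x y : G) (j : ℤ) : (x - y) j = x j - y j := by
  rw [sub_eq_add_neg, add_apply, neg_apply, sub_eq_add_neg]

@[simp] theorem rho_apply (x : G) (j : ℤ) : rho x j = x (j + 1) := rfl
@[simp] theorem sigma_apply (x : G) (j : ℤ) : sigma x j = x (j - 1) := rfl

theorem continuous_rho : Continuous rho := by
  refine continuous_of_continuousAt_zero rho ?_
  rw [ContinuousAt, map_zero, nhds_zero_hasBasis.tendsto_right_iff]
  intro N _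
  filter_upwards [U_mem_nhds_zero (N + 1)] with x hx j hj
  exact hx _ (by omega)

theorem continuous_sigma : Continuous sigma := by
  refine continuous_of_continuousAt_zero sigma ?_
  rw [ContinuousAt, map_zero, nhds_zero_hasBasis.tendsto_right_iff]
  intro N _
  filter_upwards [U_mem_nhds_zero N] with x hx j hj
  exact hx _ (by omega)

theorem isCompact_U_neg (N : ℕ) : IsCompact (U (-(N : ℤ)) : Set G) := by
  induction N with
  | zero => exact isCompact_U_zero
  | succ N ih =>
    convert ih.image continuous_rho using 1
    ext x
    constructor
    · intro hx
      refine ⟨sigma x, fun j hj => hx _ (by push_cast; omega), ?_⟩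
      exact rho.apply_symm_apply x
    · rintro ⟨y, hy, rfl⟩ j hj
      exact hy _ (by push_cast at hj; omega)

theorem iUnion_U_neg : ⋃ N : ℕ, (U (-(N : ℤ)) : Set G) = Set.univ := by
  refine Set.eq_univ_of_forall fun x => ?_
  obtain ⟨k, hk⟩ := x.2
  exact Set.mem_iUnion.2 ⟨k.natAbs + 1, fun j hj => hk j (by omega)⟩

instance : SigmaCompactSpace G :=
  ⟨⟨fun N => U (-(N : ℤ)), isCompact_U_neg, iUnion_U_neg⟩⟩

instance : TopologicalSpace.PseudoMetrizableSpace G := by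
  let := IsTopologicalAddGroup.rightUniformSpace G
  have := isUniformAddGroup_of_addCommGroup (G := G)
  have : (uniformity G).IsCountablyGenerated := by
    rw [uniformity_eq_comap_nhds_zero]
    infer_instance
  infer_instance

/-- Second countability makes the Borel σ-algebra of G × G the product σ-algebra, on which the
Fubini and shear arguments rest. -/
instance : SecondCountableTopology G := by
  let := TopologicalSpace.pseudoMetrizableSpacePseudoMetric G
  exact EMetric.secondCountable_of_sigmaCompact G

instance : T2Space G := by
  refine IsTopologicalAddGroup.t2Space_of_zero_sep fun x hx => ?_
  have : ∃ j, x j ≠ 0 := by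
    by_contra! h
    exact hx (G.ext h)
  obtain ⟨j, hj⟩ := this
  exact ⟨U j, U_mem_nhds_zero j, fun h => hj (h j le_rfl)⟩

instance : LocallyCompactSpace G :=
  isCompact_U_zero.locallyCompactSpace_of_mem_nhds_of_addGroup (U_mem_nhds_zero 0)

/-! ### Unit coordinates and balls -/

/-- The element whose only nonzero coordinate has index `k`. -/
def unit (k : ℤ) : G := G.mk (fun j => if j = k then 1 else 0) ⟨k, fun j hj => if_neg (by omega)⟩

theorem unit_apply (k j : ℤ) : unit k j = if j = k then 1 else 0 := rfl

theorem pointOne_eq : pointOne = unit 1 := rfl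

/-- The coset `a + U_l`. -/
def ball (a : G) (l : ℤ) : Set G := {x | ∀ j ≤ l, x j = a j}

theorem ball_eq (a : G) (l : ℤ) : ball a l = (fun x => x - a) ⁻¹' (U l : Set G) := by
  ext x
  simp [ball, mem_U, sub_eq_zero]

theorem ball_zero (l : ℤ) : ball 0 l = U l := rfl

theorem isOpen_ball (a : G) (l : ℤ) : IsOpen (ball a l) := by
  rw [ball_eq]
  exact (isOpen_U l).preimage (by fun_prop)

theorem measurableSet_ball (a : G) (l : ℤ) : MeasurableSet (ball a l) :=
  (isOpen_ball a l).measurableSet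

theorem mem_ball_self (a : G) (l : ℤ) : a ∈ ball a l := fun _ _ => rfl

theorem haar_ball (a : G) (l : ℤ) : haar (ball a l) = haar (U l : Set G) := by
  rw [ball_eq]
  exact (measurePreserving_sub_right haar a).measure_preimage (measurableSet_U l).nullMeasurableSet

theorem ball_split (a : G) (l : ℤ) :
    ball a l = ball a (l + 1) ∪ ball (a + unit (l + 1)) (l + 1) := by
  ext x
  constructor
  · intro hx
    by_cases h : x (l + 1) = a (l + 1)
    · left
      intro j hj
      rcases hj.lt_or_eq with h' | rfl
      · exact hx j (by omega)
      · exact h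
    · right
      intro j hj
      rw [add_apply, unit_apply]
      split_ifs with h'
      · subst h'
        revert h
        generalize x (l + 1) = u, a (l + 1) = v
        revert u v; decide
      · rw [add_zero]; exact hx j (by omega)
  · rintro (hx | hx) j hj
    · exact hx j (by omega)
    · rw [hx j (by omega), add_apply, unit_apply, if_neg (by omega), add_zero]

theorem ball_split_disjoint (a : G) (l : ℤ) :
    Disjoint (ball a (l + 1)) (ball (a + unit (l + 1)) (l + 1)) := by
  rw [Set.disjoint_left]
  intro x h1 h2
  have := (h1 (l + 1) le_rfl).symm.trans (h2 (l + 1) le_rfl)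
  rw [add_apply, unit_apply, if_pos rfl] at this
  revert this
  generalize a (l + 1) = v
  revert v; decide

theorem haar_U_succ (l : ℤ) : haar (U l : Set G) = 2 * haar (U (l + 1) : Set G) := by
  rw [← ball_zero, ball_split, measure_union (ball_split_disjoint 0 l) (measurableSet_ball _ _),
    haar_ball, haar_ball, two_mul]

theorem haar_U_zero : haar (U 0 : Set G) = 1 := Measure.addHaarMeasure_self

theorem haar_U (l : ℤ) : haar (U l : Set G) = (2 : ℝ≥0∞) ^ (-l) := by
  induction l with
  | zero => simpa using haar_U_zero
  | succ i ih =>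
    have h := haar_U_succ i
    rw [ih, neg_add, ENNReal.zpow_add two_ne_zero ENNReal.ofNat_ne_top] at *
    rw [h, zpow_neg_one, mul_comm, ← mul_assoc, ENNReal.inv_mul_cancel two_ne_zero ENNReal.ofNat_ne_top, one_mul]
  | pred i ih =>
    have h := haar_U_succ (-i - 1)
    rw [h, sub_add_cancel, ih, ← neg_add', neg_neg, neg_neg,
      ENNReal.zpow_add two_ne_zero ENNReal.ofNat_ne_top, zpow_one, mul_comm]

theorem haar_U_ne_top (l : ℤ) : haar (U l : Set G) ≠ ∞ := by
  rw [haar_U]; exact ENNReal.zpow_ne_top two_ne_zero ENNReal.ofNat_ne_top _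

/-! ### The pairing `chi` -/

/-- The nontrivial character of `ZMod 2`. -/
def sgn (a : ZMod 2) : ℂ := (-1) ^ a.val

theorem sgn_zero : sgn 0 = 1 := by simp [sgn]

theorem sgn_one : sgn 1 = -1 := by simp [sgn, ZMod.val_one]

theorem zmod_two_cases (a : ZMod 2) : a = 0 ∨ a = 1 := by revert a; decide

theorem sgn_add (a b : ZMod 2) : sgn (a + b) = sgn a * sgn b := by
  have h : (1 : ZMod 2) + 1 = 0 := by decide
  rcases zmod_two_cases a with rfl | rfl <;> rcases zmod_two_cases b with rfl | rfl <;>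
    simp [sgn_zero, sgn_one, h]

theorem sgn_natCast (n : ℕ) : sgn n = (-1) ^ n := by
  induction n with
  | zero => simp [sgn_zero]
  | succ n ih => rw [Nat.cast_succ, sgn_add, ih, sgn_one, pow_succ]

theorem exists_mem_U (x : G) : ∃ N : ℕ, x ∈ U (-(N : ℤ)) := by
  have := iUnion_U_neg ▸ Set.mem_univ x
  exact Set.mem_iUnion.1 this

theorem support_pairing_finite (x ω : G) :
    (Function.support fun j : ℤ => x j * ω (1 - j)).Finite := by
  obtain ⟨M, hM⟩ := exists_mem_U x
  obtain ⟨N, hN⟩ := exists_mem_U ω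
  refine (Set.finite_Icc (-(M : ℤ)) (1 + N)).subset fun j hj => ?_
  rw [Function.mem_support] at hj
  by_contra h
  rw [Set.mem_Icc, not_and_or] at h
  apply hj
  rcases h with h | h
  · rw [hM j (by omega), zero_mul]
  · rw [hN (1 - j) (by omega), mul_zero]

/-- Only the parity of the exponent matters, so the sum may be taken in `ZMod 2`, where the pairing
is biadditive. -/
theorem chi_eq_sgn (x ω : G) : chi x ω = sgn (∑ᶠ j : ℤ, x j * ω (1 - j)) := by
  rw [chi, ← sgn_natCast]
  congr 1
  have h : (Function.support fun j : ℤ => (x j).val * (ω (1 - j)).val).Finite := by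
    refine (support_pairing_finite x ω).subset fun j hj => ?_
    rw [Function.mem_support] at hj ⊢
    simpa [ZMod.val_eq_zero] using hj
  have := (Nat.castAddMonoidHom (ZMod 2)).map_finsum h
  simpa using this

theorem chi_add_left (x y ω : G) : chi (x + y) ω = chi x ω * chi y ω := by
  rw [chi_eq_sgn, chi_eq_sgn, chi_eq_sgn, ← sgn_add,
    ← finsum_add_distrib (support_pairing_finite x ω) (support_pairing_finite y ω)]
  simp only [add_apply, add_mul]

theorem chi_add_right (x ω τ : G) : chi x (ω + τ) = chi x ω * chi x τ := by
  rw [chi_eq_sgn, chi_eq_sgn, chi_eq_sgn, ← sgn_add,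
    ← finsum_add_distrib (support_pairing_finite x ω) (support_pairing_finite x τ)]
  simp only [add_apply, mul_add]

theorem chi_eq_one_or (x ω : G) : chi x ω = 1 ∨ chi x ω = -1 := neg_one_pow_eq_or _ _

@[simp] theorem conj_chi (x ω : G) : (starRingEnd ℂ) (chi x ω) = chi x ω := by
  rcases chi_eq_one_or x ω with h | h <;> simp [h]

@[simp] theorem norm_chi (x ω : G) : ‖chi x ω‖ = 1 := by
  rcases chi_eq_one_or x ω with h | h <;> simp [h]

/-- Every term has a zero factor: x_j for j ≤ -k, and ω_{1-j} for j > -k. -/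
theorem chi_eq_one {x ω : G} {k : ℤ} (hx : x ∈ U (-k)) (hω : ω ∈ U k) : chi x ω = 1 := by
  rw [chi_eq_sgn, ← sgn_zero]
  congr 1
  refine finsum_eq_zero_of_forall_eq_zero fun j => ?_
  rcases le_or_gt j (-k) with h | h
  · rw [hx j h, zero_mul]
  · rw [hω (1 - j) (by omega), mul_zero]

theorem chi_eq_one_of_Lam {n ω : G} (hn : n ∈ Lam) (hω : ω ∈ Lam) : chi n ω = 1 := by
  rw [chi_eq_sgn, ← sgn_zero]
  congr 1
  refine finsum_eq_zero_of_forall_eq_zero fun j => ?_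
  rcases le_or_gt j 0 with h | h
  · rw [hω (1 - j) (by omega), mul_zero]
  · rw [hn j h, zero_mul]

theorem chi_unit_left (k : ℤ) (ω : G) : chi (unit k) ω = sgn (ω (1 - k)) := by
  rw [chi_eq_sgn, finsum_eq_single _ k, unit_apply, if_pos rfl, one_mul]
  intro j hj
  rw [unit_apply, if_neg hj, zero_mul]

theorem chi_unit_right (x : G) (k : ℤ) : chi x (unit k) = sgn (x (1 - k)) := by
  rw [chi_eq_sgn, finsum_eq_single _ (1 - k), unit_apply, if_pos (by omega), mul_one]
  intro j hj
  rw [unit_apply, if_neg (by omega), mul_zero]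

theorem continuous_chi : Continuous fun p : G × G => chi p.1 p.2 := by
  rw [continuous_iff_continuousAt]
  rintro ⟨x, ω⟩
  obtain ⟨M, hM⟩ := exists_mem_U x
  obtain ⟨N, hN⟩ := exists_mem_U ω
  have hopen : ball x N ×ˢ ball ω (max M N : ℕ) ∈ 𝓝 (x, ω) :=
    prod_mem_nhds ((isOpen_ball _ _).mem_nhds (mem_ball_self _ _))
      ((isOpen_ball _ _).mem_nhds (mem_ball_self _ _))
  refine ContinuousAt.congr (f := fun _ => chi x ω) continuousAt_const ?_
  filter_upwards [hopen] with p hp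
  obtain ⟨h1, h2⟩ := hp
  rw [ball_eq] at h1 h2
  have e1 : p.1 = x + (p.1 - x) := by abel
  have e2 : p.2 = ω + (p.2 - ω) := by abel
  -- By biadditivity the value is `chi x ω` times three factors, each equal to one on this
  -- neighbourhood; so `chi` is locally constant.
  rw [e1, e2, chi_add_left, chi_add_right, chi_add_right,
    chi_eq_one hM (U_anti (by simp) h2), chi_eq_one (x := p.1 - x) (k := -N) ?_ hN,
    chi_eq_one (k := (max M N : ℕ)) (U_anti (by push_cast; omega) h1) h2]
  · simp
  · rw [neg_neg]; exact h1

theorem continuous_chi_right (x : G) : Continuous (chi x) :=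
  continuous_chi.comp (continuous_const.prodMk continuous_id)

theorem continuous_chi_left (ω : G) : Continuous fun x => chi x ω :=
  continuous_chi.comp (continuous_id.prodMk continuous_const)

theorem chi_eq_chi_of_ball {N : ℤ} {x ω τ : G} (hx : x ∈ U (-N)) (h : ω ∈ ball τ N) :
    chi x ω = chi x τ := by
  rw [ball_eq] at h
  rw [show ω = τ + (ω - τ) by abel, chi_add_right, chi_eq_one hx h, mul_one]

theorem haar_real_U (l : ℤ) : haar.real (U l : Set G) = (2 : ℝ) ^ (-l) := by
  rw [Measure.real, haar_U, show (2 : ℝ≥0∞) = ((2 : NNReal) : ℝ≥0∞) from rfl,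
    ← ENNReal.coe_zpow two_ne_zero, ENNReal.coe_toReal, NNReal.coe_zpow, NNReal.coe_ofNat]

/-- The integral of a character over the subgroup `U_{-k}`. -/
theorem setIntegral_chi (x : G) (k : ℤ) :
    ∫ ω in (U (-k) : Set G), chi x ω ∂haar =
      (U k : Set G).indicator (fun _ => ((2 : ℝ) ^ k : ℂ)) x := by
  by_cases hx : x ∈ U k
  · rw [Set.indicator_of_mem hx, setIntegral_congr_fun (g := fun _ => (1 : ℂ)) (measurableSet_U _)
      fun ω hω => chi_eq_one (k := -k) (by simpa using hx) hω]
    simp [haar_real_U]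
  · rw [Set.indicator_of_notMem hx]
    obtain ⟨j, hj, hxj⟩ : ∃ j ≤ k, x j ≠ 0 := by
      by_contra! h
      exact hx h
    -- Translation by this element of U_{-k} flips the sign of the character, so the integral equals
    -- its own negative.
    have hu : unit (1 - j) ∈ U (-k) := fun i hi => by rw [unit_apply, if_neg (by omega)]
    have hχ : chi x (unit (1 - j)) = -1 := by
      rw [chi_unit_right, sub_sub_cancel, (zmod_two_cases _).resolve_left hxj, sgn_one]
    have key : ∫ ω in (U (-k) : Set G), chi x ω ∂haar
        = - ∫ ω in (U (-k) : Set G), chi x ω ∂haar := by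
      rw [← integral_neg, ← integral_indicator (measurableSet_U _),
        ← integral_indicator (measurableSet_U _),
        ← integral_add_right_eq_self _ (unit (1 - j))]
      congr 1
      ext ω
      by_cases hω : ω ∈ U (-k)
      · rw [Set.indicator_of_mem (show ω + unit (1 - j) ∈ (U (-k) : Set G) from add_mem hω hu),
          Set.indicator_of_mem (show ω ∈ (U (-k) : Set G) from hω), chi_add_right, hχ, mul_neg_one]
      · rw [Set.indicator_of_notMem, Set.indicator_of_notMem hω]
        exact fun h => hω ((add_mem_cancel_right hu).1 h)
    exact self_eq_neg.1 key

/-! ### Comparison of measures on balls -/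

/-- Halve the ball repeatedly, by induction on N - l: at level N each ball either lies in S or
misses it. -/
theorem measure_ball_inter_le {μ ν : Measure G} {S : Set G} {a : G} {N l : ℕ}
    (hS : ∀ x ∈ S, ball x N ⊆ S) (hl : l ≤ N) (h : ∀ b ∈ ball a l, ∀ k : ℕ, μ (ball b k) ≤ ν (ball b k)) :
    μ (ball a l ∩ S) ≤ ν (ball a l ∩ S) := by
  induction hd : N - l generalizing l a with
  | zero =>
    obtain rfl : N = l := by omega
    by_cases hne : ∃ x ∈ ball a N, x ∈ S
    · obtain ⟨x, hx, hxS⟩ := hne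
      have : ball a N ⊆ S := fun y hy => hS x hxS fun j hj => (hy j hj).trans (hx j hj).symm
      rw [Set.inter_eq_left.2 this]
      exact h a (mem_ball_self _ _) N
    · have : ball a N ∩ S = ∅ := by
        ext x
        simp only [Set.mem_inter_iff, Set.mem_empty_iff_false, iff_false]
        exact fun hx => hne ⟨x, hx⟩
      simp [this]
  | succ d ih =>
    have hm := measurableSet_ball (a + unit ((l : ℤ) + 1)) ((l : ℤ) + 1)
    have hsplit := ball_split a l
    have key : ∀ ρ : Measure G, ρ (ball a l ∩ S) = ρ (ball a (l + 1 : ℕ) ∩ S)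
        + ρ (ball (a + unit ((l : ℤ) + 1)) (l + 1 : ℕ) ∩ S) := by
      intro ρ
      push_cast
      rw [← measure_inter_add_sdiff (ball a l ∩ S) (measurableSet_ball a ((l : ℤ) + 1))]
      have hd := Set.disjoint_left.1 (ball_split_disjoint a l)
      congr 2 <;> ext x <;> simp only [hsplit, Set.mem_inter_iff, Set.mem_sdiff, Set.mem_union] <;>
        have := @hd x <;> tauto
    rw [key μ, key ν]
    refine add_le_add (ih (by omega) (fun b hb => h b ?_) (by omega))
      (ih (by omega) (fun b hb => h b ?_) (by omega)) <;> rw [hsplit]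
    · exact Or.inl (by exact_mod_cast hb)
    · exact Or.inr (by exact_mod_cast hb)

/-- Open sets are increasing unions of sets made of N-balls; an arbitrary S is then reached by outer
regularity of the finite measure ν. This plays the role of a differentiation theorem. -/
theorem measure_inter_ball_le {μ ν : Measure G} [IsFiniteMeasure ν] {a : G}
    (h : ∀ b ∈ ball a 0, ∀ k : ℕ, μ (ball b k) ≤ ν (ball b k)) {S : Set G} :
    μ (ball a 0 ∩ S) ≤ ν (ball a 0 ∩ S) := by
  have hopen : ∀ O : Set G, IsOpen O → μ (ball a 0 ∩ O) ≤ ν (ball a 0 ∩ O) := by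
    intro O hO
    let A : ℕ → Set G := fun N => {x | ball x N ⊆ O}
    have hA : O = ⋃ N, A N := by
      ext x
      rw [Set.mem_iUnion]
      constructor
      · intro hx
        have : (fun y => x + y) ⁻¹' O ∈ 𝓝 (0 : G) :=
          (hO.preimage (by fun_prop)).mem_nhds (by simpa using hx)
        obtain ⟨N, -, hN⟩ := nhds_zero_hasBasis.mem_iff.1 this
        refine ⟨N, fun y hy => ?_⟩
        rw [ball_eq] at hy
        have := hN hy
        simpa using this
      · rintro ⟨N, hN⟩
        exact hN (mem_ball_self x N)
    have hmono : Monotone fun N => ball a 0 ∩ A N := by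
      intro M N hMN x hx
      exact ⟨hx.1, fun y hy => hx.2 fun j hj => hy j (hj.trans (by exact_mod_cast hMN))⟩
    rw [hA, Set.inter_iUnion, hmono.measure_iUnion, hmono.measure_iUnion]
    refine iSup_mono fun N => ?_
    refine measure_ball_inter_le (N := N) (l := 0) (fun x hx y hy => ?_) (by omega) h
    exact fun z hz => hx fun j hj => (hz j hj).trans (hy j hj)
  have := Set.measure_eq_iInf_isOpen (ball a 0 ∩ S) ν
  rw [this]
  refine le_iInf₂ fun O hSO => le_iInf fun hO => ?_
  calc μ (ball a 0 ∩ S) ≤ μ (ball a 0 ∩ O) := measure_mono fun x hx => ⟨hx.1, hSO hx⟩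
    _ ≤ ν (ball a 0 ∩ O) := hopen O hO
    _ ≤ ν O := measure_mono Set.inter_subset_right

/-- Apply the comparison of measures to those with densities f and g on D; finiteness of the
integral of g supplies the outer regularity. -/
theorem ae_le_of_setLIntegral_ball_le {f g : G → ℝ≥0∞}
    (hf : AEMeasurable f (haar.restrict (U 0 : Set G)))
    (hgi : ∫⁻ x in (U 0 : Set G), g x ∂haar ≠ ∞)
    (h : ∀ b ∈ U 0, ∀ k : ℕ, ∫⁻ x in ball b k, f x ∂haar ≤ ∫⁻ x in ball b k, g x ∂haar) :
    f ≤ᵐ[haar.restrict (U 0 : Set G)] g := by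
  have hsub : ∀ b ∈ U 0, ∀ k : ℕ, ball b k ⊆ (U 0 : Set G) := fun b hb k x hx j hj =>
    (hx j (by omega)).trans (hb j hj)
  let μ := (haar.restrict (U 0 : Set G)).withDensity f
  let ν := (haar.restrict (U 0 : Set G)).withDensity g
  have hν : IsFiniteMeasure ν := isFiniteMeasure_withDensity hgi
  have hb : ∀ b ∈ ball 0 0, ∀ k : ℕ, μ (ball b k) ≤ ν (ball b k) := by
    intro b hb k
    rw [withDensity_apply _ (measurableSet_ball _ _), withDensity_apply _ (measurableSet_ball _ _),
      Measure.restrict_restrict (measurableSet_ball _ _), Set.inter_eq_left.2 (hsub b hb k)]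
    exact h b hb k
  refine ae_le_of_forall_setLIntegral_le_of_sigmaFinite₀ hf fun s hs _ => ?_
  have key := measure_inter_ball_le (μ := μ) (ν := ν) hb (S := s)
  rw [ball_zero, withDensity_apply _ ((measurableSet_U 0).inter hs),
    withDensity_apply _ ((measurableSet_U 0).inter hs),
    Measure.restrict_restrict ((measurableSet_U 0).inter hs), Set.inter_right_comm,
    Set.inter_self, Set.inter_comm, ← Measure.restrict_restrict hs] at key
  exact key

/-! ### Plancherel's identity for integrable functions in `L²(G)` -/

instance : haar.Regular := inferInstanceAs (Measure.addHaarMeasure compactD).Regular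

/-- This makes the autocorrelation u ↦ ⟨h, T_u h⟩ continuous, so that its averages over the
shrinking U_k tend to ‖h‖². -/
theorem continuous_translate (f : L2) : Continuous fun y => translate y f := by
  let g : C(G, C(G, G)) := (ContinuousMap.mk (fun p : G × G => p.2 - p.1) (by fun_prop)).curry
  exact Continuous.compMeasurePreservingLp (g := g) (f := fun _ : G => f) continuous_const
    g.continuous (fun y => measurePreserving_sub_right haar y) ENNReal.ofNat_ne_top

theorem coeFn_translate (y : G) (f : L2) : translate y f =ᵐ[haar] fun x => f (x - y) :=
  Lp.coeFn_compMeasurePreserving f (measurePreserving_sub_right haar y)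

theorem translate_zero (f : L2) : translate 0 f = f := by
  refine Lp.ext ((coeFn_translate 0 f).trans ?_)
  simp

/-- The Fourier integral of a function on `G`. -/
def fourier (h : G → ℂ) (ω : G) : ℂ := ∫ x, h x * chi x ω ∂haar

theorem integrable_mul_chi {h : G → ℂ} (hi : Integrable h haar) (ω : G) :
    Integrable (fun x => h x * chi x ω) haar :=
  hi.mul_bdd (c := 1) (continuous_chi_left ω).aestronglyMeasurable (by simp)

theorem continuous_fourier {h : G → ℂ} (hi : Integrable h haar) : Continuous (fourier h) := by
  refine continuous_of_dominated (bound := fun x => ‖h x‖) (fun ω => ?_) (fun ω => ?_) hi.norm ?_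
  · exact (integrable_mul_chi hi ω).aestronglyMeasurable
  · simp
  · exact Eventually.of_forall fun x => continuous_const.mul (continuous_chi_right x)

theorem integrable_conj_mul_prod {h : G → ℂ} (hi : Integrable h haar) :
    Integrable (fun z : G × G => (starRingEnd ℂ) (h z.1) * h z.2) (haar.prod haar) := by
  have hc : Integrable (fun x => (starRingEnd ℂ) (h x)) haar :=
    (LinearIsometryEquiv.integrable_comp_iff Complex.conjLIE).2 hi
  exact hc.mul_prod hi

theorem conj_mul_fourier {h : G → ℂ} (ω : G) :
    (starRingEnd ℂ) (fourier h ω) * fourier h ω =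
      ∫ z : G × G, (starRingEnd ℂ) (h z.1) * h z.2 * chi (z.1 + z.2) ω ∂(haar.prod haar) := by
  have h1 : (starRingEnd ℂ) (fourier h ω) = ∫ x, (starRingEnd ℂ) (h x) * chi x ω ∂haar := by
    rw [fourier, ← integral_conj]
    simp
  rw [h1, fourier, ← integral_prod_mul]
  congr 1
  ext z
  rw [chi_add_left]
  ring

theorem integrable_kernel {h : G → ℂ} (hi : Integrable h haar) (k : ℤ) :
    Integrable (fun z : G × G => (starRingEnd ℂ) (h z.1) * h z.2 *
      (U k : Set G).indicator (fun _ => ((2 : ℝ) ^ k : ℂ)) (z.1 + z.2)) (haar.prod haar) := by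
  refine (integrable_conj_mul_prod hi).mul_bdd (c := 2 ^ k) ?_ (Eventually.of_forall fun z => ?_)
  · have : Measurable fun z : G × G =>
        (U k : Set G).indicator (fun _ => ((2 : ℝ) ^ k : ℂ)) (z.1 + z.2) :=
      (measurable_const.indicator (measurableSet_U k)).comp (measurable_fst.add measurable_snd)
    exact this.aestronglyMeasurable
  · refine (norm_indicator_le_norm_self _ _).trans (le_of_eq ?_)
    simp

/-- By Fubini the frequency integral reduces to that of a character over U_{-k}, namely 2^k times
the indicator of U_k; what remains is the average of the autocorrelation of h over U_k. -/
theorem setIntegral_conj_mul_fourier {h : G → ℂ} (hi : Integrable h haar) (k : ℤ) :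
    ∫ ω in (U (-k) : Set G), (starRingEnd ℂ) (fourier h ω) * fourier h ω ∂haar =
      ∫ u in (U k : Set G), ((2 : ℝ) ^ k : ℂ) *
        ∫ y, (starRingEnd ℂ) (h y) * h (y + u) ∂haar ∂haar := by
  have hfin : IsFiniteMeasure (haar.restrict (U (-k) : Set G)) :=
    ⟨by simpa using (haar_U_ne_top (-k)).lt_top⟩
  simp_rw [conj_mul_fourier]
  rw [integral_integral_swap]
  · simp_rw [integral_const_mul, setIntegral_chi]
    -- The shear (y, u) ↦ (y, y + u) turns the kernel's argument into y + (y + u) = u, as every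
    -- element is its own inverse.
    have hmp := measurePreserving_prod_add (G := G) haar haar
    have hint := hmp.integrable_comp_of_integrable (integrable_kernel hi k)
    simp only [Function.comp_def] at hint
    rw [← integral_const_mul,
      ← hmp.integral_comp (MeasurableEquiv.shearAddRight G).measurableEmbedding,
      integral_prod_symm _ hint, ← integral_indicator (measurableSet_U k)]
    congr 1
    ext u
    have hu : ∀ y : G, y + (y + u) = u := fun y => by rw [← add_assoc, add_self', zero_add]
    simp only [hu]
    rw [integral_mul_const]
    by_cases h : u ∈ (U k : Set G)
    · rw [Set.indicator_of_mem h, Set.indicator_of_mem h, mul_comm]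
    · rw [Set.indicator_of_notMem h, Set.indicator_of_notMem h, mul_zero]
  · have h1 : Integrable (fun p : G × (G × G) => (1 : ℂ) *
        ((starRingEnd ℂ) (h p.2.1) * h p.2.2))
        ((haar.restrict (U (-k) : Set G)).prod (haar.prod haar)) :=
      (integrable_const (1 : ℂ)).mul_prod (integrable_conj_mul_prod hi)
    refine (h1.mul_bdd (c := 1) (g := fun p => chi (p.2.1 + p.2.2) p.1) ?_ (by simp)).congr
      (Eventually.of_forall fun p => by simp [Function.uncurry])
    refine Continuous.aestronglyMeasurable ?_
    exact continuous_chi.comp (by fun_prop : Continuous fun p : G × (G × G) =>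
      (p.2.1 + p.2.2, p.1))

theorem tendsto_average {ρ : G → ℂ} (hρ : Continuous ρ) :
    Tendsto (fun k : ℕ => ∫ u in (U k : Set G), ((2 : ℝ) ^ (k : ℤ) : ℂ) * ρ u ∂haar) atTop
      (𝓝 (ρ 0)) := by
  rw [Metric.tendsto_atTop]
  intro ε hε
  obtain ⟨N, -, hN⟩ := nhds_zero_hasBasis.mem_iff.1
    (hρ.continuousAt.preimage_mem_nhds (Metric.ball_mem_nhds (ρ 0) (half_pos hε)))
  refine ⟨N, fun k hk => ?_⟩
  have hint : IntegrableOn (fun u => ((2 : ℝ) ^ (k : ℤ) : ℂ) * ρ u) (U k : Set G) haar := by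
    refine ContinuousOn.integrableOn_of_subset_isCompact (K := (U 0 : Set G)) ?_
      isCompact_U_zero (measurableSet_U k) (U_anti (by omega))
      (haar_U_ne_top k)
    fun_prop
  have hconst : ∫ _ in (U k : Set G), ((2 : ℝ) ^ (k : ℤ) : ℂ) * ρ 0 ∂haar = ρ 0 := by
    rw [setIntegral_const, haar_real_U, Complex.real_smul, ← mul_assoc]
    push_cast
    rw [← zpow_add₀ two_ne_zero, neg_add_cancel, zpow_zero, one_mul]
  have hfin : haar (U k : Set G) < ∞ := (haar_U_ne_top k).lt_top
  rw [dist_eq_norm]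
  nth_rw 1 [← hconst]
  rw [← integral_sub hint (integrableOn_const hfin.ne)]
  have hb := norm_setIntegral_le_of_norm_le_const (μ := haar) (s := (U k : Set G))
    (f := fun u => ((2 : ℝ) ^ (k : ℤ) : ℂ) * ρ u - ((2 : ℝ) ^ (k : ℤ) : ℂ) * ρ 0)
    (C := 2 ^ (k : ℤ) * (ε / 2)) hfin fun u hu => by
      have := hN (U_anti (by exact_mod_cast hk) hu)
      rw [← mul_sub, norm_mul]
      refine mul_le_mul (by simp) (mem_ball_iff_norm.1 this).le (norm_nonneg _) (by positivity)
  refine hb.trans_lt ?_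
  rw [haar_real_U, mul_comm, ← mul_assoc, ← zpow_add₀ two_ne_zero, neg_add_cancel, zpow_zero, one_mul]
  exact half_lt_self hε

theorem inner_translate_eq (h : L2) (u : G) :
    inner ℂ h (translate u h) = ∫ y, (starRingEnd ℂ) (h y) * h (y + u) ∂haar := by
  rw [L2.inner_def]
  refine integral_congr_ae ?_
  filter_upwards [coeFn_translate u h] with y hy
  rw [hy, RCLike.inner_apply', sub_eq_add']

/-- Exhaust G by the U_{-k}: the energy on U_{-k} is an average of the autocorrelation over U_k, and
these averages converge to its value ‖h‖² at 0. -/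
theorem lintegral_fourier (h : L2) (hi : Integrable h haar) :
    ∫⁻ ω, ‖fourier h ω‖ₑ ^ 2 ∂haar = ‖h‖ₑ ^ 2 := by
  have hcont := continuous_fourier hi
  have hlim1 : Tendsto (fun k : ℕ => ∫⁻ ω in (U (-(k : ℤ)) : Set G), ‖fourier h ω‖ₑ ^ 2 ∂haar)
      atTop (𝓝 (∫⁻ ω, ‖fourier h ω‖ₑ ^ 2 ∂haar)) := by
    have hmono : Monotone fun k : ℕ => (U (-(k : ℤ)) : Set G) := fun a b hab =>
      U_anti (by omega)
    have := tendsto_measure_iUnion_atTop (μ := haar.withDensity fun ω => ‖fourier h ω‖ₑ ^ 2) hmono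
    rw [iUnion_U_neg] at this
    simpa [withDensity_apply, measurableSet_U, Function.comp_def] using this
  refine tendsto_nhds_unique hlim1 ?_
  have hρ : Continuous fun u => ∫ y, (starRingEnd ℂ) (h y) * h (y + u) ∂haar := by
    simp_rw [← inner_translate_eq]
    exact continuous_const.inner (continuous_translate h)
  have hlim2 := tendsto_average hρ
  simp only [← setIntegral_conj_mul_fourier hi] at hlim2
  rw [← inner_translate_eq, translate_zero, inner_self_eq_norm_sq_to_K] at hlim2
  have hlim3 := (ENNReal.continuous_ofReal.tendsto _).comp
    ((Complex.continuous_re.tendsto _).comp hlim2)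
  have e1 : ENNReal.ofReal ((((‖h‖ : ℝ) : ℂ) ^ 2).re) = ‖h‖ₑ ^ 2 := by
    rw [← Complex.ofReal_pow, Complex.ofReal_re, ENNReal.ofReal_pow (norm_nonneg _),
      ofReal_norm]
  refine (e1 ▸ hlim3).congr fun k => ?_
  have e2 : ∀ z : ℂ, (starRingEnd ℂ) z * z = ((‖z‖ ^ 2 : ℝ) : ℂ) := fun z => by
    rw [Complex.conj_mul']; push_cast; rfl
  simp only [Function.comp_apply, e2]
  rw [integral_complex_ofReal, Complex.ofReal_re, ofReal_integral_eq_lintegral_ofReal]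
  · simp [ENNReal.ofReal_pow, ofReal_norm]
  · exact ContinuousOn.integrableOn_compact (isCompact_U_neg k) (by fun_prop)
  · exact Eventually.of_forall fun ω => by positivity

/-! ### The Fourier transform on `L²(G)` -/

theorem eLpNorm_two_sq (f : G → ℂ) (μ : Measure G) :
    eLpNorm f 2 μ ^ 2 = ∫⁻ x, ‖f x‖ₑ ^ 2 ∂μ := by
  have := eLpNorm_nnreal_pow_eq_lintegral (μ := μ) (f := f) (p := 2) two_ne_zero
  simpa using this

theorem enorm_sq_eq (f : L2) : ‖f‖ₑ ^ 2 = ∫⁻ x, ‖f x‖ₑ ^ 2 ∂haar := by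
  rw [Lp.enorm_def, eLpNorm_two_sq]

theorem integrableOn_L2 (f : L2) (l : ℤ) : IntegrableOn f (U l : Set G) haar := by
  have hfin : IsFiniteMeasure (haar.restrict (U l : Set G)) :=
    ⟨by simpa using (haar_U_ne_top l).lt_top⟩
  exact ((Lp.memLp f).restrict _).integrable one_le_two

/-- The Fourier integral of `f ∈ L²(G)` over `U_{-N}`. -/
def truncFourier (f : L2) (N : ℕ) : G → ℂ := fourier ((U (-(N : ℤ)) : Set G).indicator f)

theorem truncFourier_eq (f : L2) (N : ℕ) (ω : G) :
    truncFourier f N ω = ∫ x in (U (-(N : ℤ)) : Set G), f x * (starRingEnd ℂ) (chi x ω) ∂haar := by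
  rw [truncFourier, fourier, ← integral_indicator (measurableSet_U _)]
  congr 1
  ext x
  simp only [conj_chi]
  by_cases hx : x ∈ (U (-(N : ℤ)) : Set G)
  · rw [Set.indicator_of_mem hx, Set.indicator_of_mem hx]
  · rw [Set.indicator_of_notMem hx, Set.indicator_of_notMem hx, zero_mul]

theorem continuous_truncFourier (f : L2) (N : ℕ) : Continuous (truncFourier f N) :=
  continuous_fourier ((integrable_indicator_iff (measurableSet_U _)).2 (integrableOn_L2 f _))

theorem isFourierTransform_iff {f : L2} {g : G → ℂ} : IsFourierTransform f g ↔ MemLp g 2 haar ∧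
    Tendsto (fun N : ℕ => eLpNorm (truncFourier f N - g) 2 haar) atTop (𝓝 0) := by
  have : ∀ N, (truncFourier f N - g) = fun ω =>
      (∫ x in (U (-(N : ℤ)) : Set G), f x * (starRingEnd ℂ) (chi x ω) ∂haar) - g ω := by
    intro N
    ext ω
    rw [Pi.sub_apply, truncFourier_eq]
  simp_rw [this]
  rfl

theorem lintegral_truncFourier (f : L2) (N : ℕ) :
    ∫⁻ ω, ‖truncFourier f N ω‖ₑ ^ 2 ∂haar = ∫⁻ x in (U (-(N : ℤ)) : Set G), ‖f x‖ₑ ^ 2 ∂haar := by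
  have hm : MemLp ((U (-(N : ℤ)) : Set G).indicator f) 2 haar :=
    (Lp.memLp f).indicator (measurableSet_U _)
  have hi : Integrable ((U (-(N : ℤ)) : Set G).indicator f) haar :=
    (integrable_indicator_iff (measurableSet_U _)).2 (integrableOn_L2 f _)
  have h := lintegral_fourier (hm.toLp _) (hi.congr hm.coeFn_toLp.symm)
  have e : fourier (hm.toLp _) = truncFourier f N := by
    ext ω
    refine integral_congr_ae ?_
    filter_upwards [hm.coeFn_toLp] with x hx
    rw [hx]
  rw [e] at h
  rw [h, Lp.enorm_toLp, eLpNorm_two_sq, ← lintegral_indicator (measurableSet_U _)]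
  congr 1
  ext x
  by_cases hx : x ∈ (U (-(N : ℤ)) : Set G)
  · rw [Set.indicator_of_mem hx, Set.indicator_of_mem hx]
  · rw [Set.indicator_of_notMem hx, Set.indicator_of_notMem hx]; simp

theorem memLp_truncFourier (f : L2) (N : ℕ) : MemLp (truncFourier f N) 2 haar := by
  refine ⟨(continuous_truncFourier f N).aestronglyMeasurable, ?_⟩
  refine (ENNReal.pow_lt_top_iff.1 ?_).resolve_right two_ne_zero
  rw [eLpNorm_two_sq, lintegral_truncFourier]
  refine (setLIntegral_le_lintegral _ _).trans_lt ?_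
  rw [← enorm_sq_eq]
  exact ENNReal.pow_lt_top enorm_lt_top

theorem tendsto_setLIntegral_U_neg (g : G → ℝ≥0∞) :
    Tendsto (fun N : ℕ => ∫⁻ x in (U (-(N : ℤ)) : Set G), g x ∂haar) atTop
      (𝓝 (∫⁻ x, g x ∂haar)) := by
  have hmono : Monotone fun k : ℕ => (U (-(k : ℤ)) : Set G) := fun a b hab =>
    U_anti (by omega)
  have := tendsto_measure_iUnion_atTop (μ := haar.withDensity g) hmono
  rw [iUnion_U_neg] at this
  simpa [withDensity_apply, measurableSet_U, Function.comp_def] using this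

/-- Plancherel's identity. -/
theorem IsFourierTransform.enorm_toLp {f : L2} {g : G → ℂ} (h : IsFourierTransform f g) :
    ‖h.1.toLp g‖ₑ = ‖f‖ₑ := by
  have h' := (isFourierTransform_iff.1 h).2
  have h1 : Tendsto (fun N => (memLp_truncFourier f N).toLp _) atTop (𝓝 (h.1.toLp g)) :=
    (Lp.tendsto_Lp_iff_tendsto_eLpNorm'' _ (memLp_truncFourier f) g h.1).2 h'
  have h2 := ((ENNReal.continuous_pow 2).tendsto _).comp ((continuous_enorm.tendsto _).comp h1)
  have h3 := tendsto_setLIntegral_U_neg fun x => ‖f x‖ₑ ^ 2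
  rw [← enorm_sq_eq] at h3
  have h4 := tendsto_nhds_unique h2 (h3.congr fun N => by
    rw [← lintegral_truncFourier, ← eLpNorm_two_sq, Function.comp_apply, Function.comp_apply,
      Lp.enorm_toLp])
  exact (ENNReal.pow_right_strictMono two_ne_zero).injective h4

theorem IsFourierTransform.add {f f' : L2} {g g' : G → ℂ} (h : IsFourierTransform f g)
    (h' : IsFourierTransform f' g') : IsFourierTransform (f + f') (g + g') := by
  rw [isFourierTransform_iff] at *
  refine ⟨h.1.add h'.1, ?_⟩
  have e : ∀ N, truncFourier (f + f') N - (g + g') =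
      (truncFourier f N - g) + (truncFourier f' N - g') := by
    intro N
    have : truncFourier (f + f') N = truncFourier f N + truncFourier f' N := by
      ext ω
      have hi : ∀ k : L2, IntegrableOn (fun x => k x * chi x ω) (U (-(N : ℤ)) : Set G) haar :=
        fun k => (integrableOn_L2 k _).mul_bdd (c := 1)
          (continuous_chi_left ω).aestronglyMeasurable (by simp)
      simp only [Pi.add_apply, truncFourier_eq, conj_chi]
      rw [← integral_add (hi f) (hi f')]
      refine setIntegral_congr_ae (measurableSet_U _) ?_
      filter_upwards [Lp.coeFn_add f f'] with x hx _
      rw [hx, Pi.add_apply, add_mul]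
    rw [this]; abel
  simp_rw [e]
  refine tendsto_of_tendsto_of_tendsto_of_le_of_le tendsto_const_nhds
    (by simpa using h.2.add h'.2) (fun N => zero_le) fun N => ?_
  exact eLpNorm_add_le ((memLp_truncFourier f N).1.sub h.1.1)
    ((memLp_truncFourier f' N).1.sub h'.1.1) one_le_two

theorem IsFourierTransform.const_smul {f : L2} {g : G → ℂ} (c : ℂ) (h : IsFourierTransform f g) :
    IsFourierTransform (c • f) (c • g) := by
  rw [isFourierTransform_iff] at *
  refine ⟨h.1.const_smul c, ?_⟩
  have e : ∀ N, truncFourier (c • f) N - c • g = c • (truncFourier f N - g) := by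
    intro N
    rw [smul_sub]
    congr 1
    ext ω
    simp only [Pi.smul_apply, truncFourier_eq, smul_eq_mul]
    rw [← integral_const_mul]
    refine setIntegral_congr_ae (measurableSet_U _) ?_
    filter_upwards [Lp.coeFn_smul c f] with x hx _
    rw [hx, Pi.smul_apply, smul_eq_mul, mul_assoc]
  simp_rw [e, eLpNorm_const_smul]
  simpa using ENNReal.Tendsto.const_mul h.2 (Or.inr enorm_ne_top)

theorem IsFourierTransform.translate {f : L2} {g : G → ℂ} (n : G) (h : IsFourierTransform f g) :
    IsFourierTransform (translate n f) (fun ω => chi n ω * g ω) := by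
  rw [isFourierTransform_iff] at *
  have hn : ∀ k : G → ℂ, eLpNorm (fun ω => chi n ω * k ω) 2 haar = eLpNorm k 2 haar := fun k =>
    eLpNorm_congr_norm_ae (Eventually.of_forall fun ω => by simp)
  refine ⟨⟨(continuous_chi_right n).aestronglyMeasurable.mul h.1.1, ?_⟩, ?_⟩
  · rw [hn]; exact h.1.2
  refine h.2.congr' ?_
  obtain ⟨M, hM⟩ := exists_mem_U n
  filter_upwards [eventually_ge_atTop M] with N hN
  rw [← hn]
  congr 1
  ext ω
  rw [Pi.sub_apply, Pi.sub_apply, mul_sub]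
  congr 1
  -- Once n lies in the subgroup U_{-N}, truncation to U_{-N} commutes with translation by n, so the
  -- truncated transforms differ exactly by the factor `chi n`.
  have hnN : n ∈ U (-(N : ℤ)) := U_anti (by omega) hM
  rw [truncFourier, truncFourier, fourier, fourier, ← integral_const_mul,
    ← integral_sub_right_eq_self _ n]
  refine integral_congr_ae ?_
  filter_upwards [coeFn_translate n f] with x hx
  have hχ : chi n ω * chi (x - n) ω = chi x ω := by rw [← chi_add_left]; congr 1; abel
  by_cases h : x ∈ U (-(N : ℤ))
  · have h' : x - n ∈ U (-(N : ℤ)) := sub_mem h hnN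
    rw [Set.indicator_of_mem (SetLike.mem_coe.2 h), Set.indicator_of_mem (SetLike.mem_coe.2 h'), hx,
      ← hχ]
    ring
  · have h' : x - n ∉ U (-(N : ℤ)) := fun h' => h (by simpa using add_mem h' hnN)
    rw [Set.indicator_of_notMem (mt SetLike.mem_coe.1 h), Set.indicator_of_notMem h']
    simp

theorem IsFourierTransform.congr {f : L2} {g g' : G → ℂ} (h : IsFourierTransform f g)
    (hg : g =ᵐ[haar] g') : IsFourierTransform f g' := by
  rw [isFourierTransform_iff] at *
  refine ⟨(memLp_congr_ae hg).1 h.1, h.2.congr fun N => eLpNorm_congr_ae ?_⟩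
  filter_upwards [hg] with ω hω
  rw [Pi.sub_apply, Pi.sub_apply, hω]

/-- Parseval's identity. -/
theorem IsFourierTransform.inner_eq {f f' : L2} {g g' : G → ℂ} (h : IsFourierTransform f g)
    (h' : IsFourierTransform f' g') :
    inner ℂ f f' = ∫ ω, (starRingEnd ℂ) (g ω) * g' ω ∂haar := by
  -- Polarization: Plancherel's identity is used for f + c f' with c = ±1, ±i.
  have key : ∀ c : ℂ, ‖f + c • f'‖ = ‖h.1.toLp g + c • h'.1.toLp g'‖ := by
    intro c
    have := (h.add (h'.const_smul c)).enorm_toLp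
    have e : (h.add (h'.const_smul c)).1.toLp _ = h.1.toLp g + c • h'.1.toLp g' := by
      rw [← MemLp.toLp_const_smul, ← MemLp.toLp_add]
    rw [e] at this
    simpa using congrArg ENNReal.toReal this.symm
  have hin : inner ℂ f f' = inner ℂ (h.1.toLp g) (h'.1.toLp g') := by
    have k1 := key 1
    have k2 := key (-1)
    have k3 := key Complex.I
    have k4 := key (-Complex.I)
    simp only [one_smul, neg_smul, ← sub_eq_add_neg] at k1 k2 k3 k4
    rw [inner_eq_sum_norm_sq_div_four, inner_eq_sum_norm_sq_div_four]
    simp only [RCLike.I_to_complex]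
    rw [k1, k2, k3, k4]
  rw [hin, L2.inner_def]
  refine integral_congr_ae ?_
  filter_upwards [h.1.coeFn_toLp, h'.1.coeFn_toLp] with ω h1 h2
  rw [h1, h2, RCLike.inner_apply']

/-! ### Localization of a scaling function to cylinders in the frequency domain -/

theorem translate_add (y : G) (f g : L2) :
    translate y (f + g) = translate y f + translate y g :=
  map_add (Lp.compMeasurePreserving (fun x => x - y) (measurePreserving_sub_right haar y)) f g

theorem translate_smul (y : G) (c : ℂ) (f : L2) : translate y (c • f) = c • translate y f :=
  map_smul (Lp.compMeasurePreservingₗ ℂ (fun x => x - y) (measurePreserving_sub_right haar y)) c f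

theorem translate_translate (x y : G) (f : L2) :
    translate x (translate y f) = translate (x + y) f := by
  refine Lp.ext ?_
  have h := (measurePreserving_sub_right haar x).quasiMeasurePreserving.ae_eq (coeFn_translate y f)
  filter_upwards [coeFn_translate x (translate y f), coeFn_translate (x + y) f, h] with z h1 h2 h3
  rw [h1, h2]
  refine h3.trans ?_
  simp only [Function.comp_apply]
  congr 1
  abel

theorem translate_mem_span {φ f : L2} {e : G} (he : e ∈ Lam)
    (hf : f ∈ Submodule.span ℂ (Set.range fun n : Lam => translate n φ)) :
    translate e f ∈ Submodule.span ℂ (Set.range fun n : Lam => translate n φ) := by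
  induction hf using Submodule.span_induction with
  | mem x hx =>
    obtain ⟨n, rfl⟩ := hx
    rw [translate_translate]
    exact Submodule.subset_span ⟨⟨e + n, add_mem he n.2⟩, rfl⟩
  | zero =>
    have : translate e (0 : L2) = 0 := by simpa using translate_smul e 0 0
    rw [this]; exact zero_mem _
  | add x y _ _ hx hy => rw [translate_add]; exact add_mem hx hy
  | smul c x _ hx => rw [translate_smul]; exact Submodule.smul_mem _ _ hx

/-- The set of all `x` that agree with `a` in the coordinates `1, …, l`. -/
def cylinder (a : G) (l : ℕ) : Set G := {x | ∀ j : ℤ, 0 < j → j ≤ l → x j = a j}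

theorem measurableSet_cylinder (a : G) (l : ℕ) : MeasurableSet (cylinder a l) := by
  refine IsOpen.measurableSet (isOpen_iff_mem_nhds.2 fun x hx => ?_)
  refine mem_of_superset ((isOpen_ball x l).mem_nhds (mem_ball_self x l)) fun y hy j h0 hj => ?_
  rw [hy j hj, hx j h0 hj]

theorem add_mem_cylinder {a n ω : G} {l : ℕ} (hn : n ∈ Lam) :
    ω + n ∈ cylinder a l ↔ ω ∈ cylinder a l := by
  have : ∀ j > 0, (ω + n) j = ω j := fun j hj => by rw [add_apply, hn j hj, add_zero]
  constructor <;> intro h j h0 hj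
  · rw [← this j h0]; exact h j h0 hj
  · rw [this j h0]; exact h j h0 hj

theorem cylinder_inter_U_zero {a : G} (ha : a ∈ U 0) (l : ℕ) :
    cylinder a l ∩ U 0 = ball a l := by
  ext x
  constructor
  · rintro ⟨h1, h2⟩ j hj
    rcases le_or_gt j 0 with h | h
    · rw [h2 j h, ha j h]
    · exact h1 j h hj
  · exact fun h => ⟨fun j _ hj => h j hj, fun j hj => (h j (by omega)).trans (ha j hj)⟩

/-- The factor (1 ± χ(e, ω))/2, with e the unit element at index -l, is the indicator of a
prescribed value of ω_{l+1} when the sign is chosen from that value. In the time domain it averages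
f with a signed translate by e ∈ Λ, so each further coordinate is fixed inside the span. -/
theorem exists_isFourierTransform_cylinder {φ : L2} {φhat : G → ℂ}
    (hφ : IsFourierTransform φ φhat) (a : G) (l : ℕ) :
    ∃ f ∈ Submodule.span ℂ (Set.range fun n : Lam => translate n φ),
      IsFourierTransform f ((cylinder a l).indicator φhat) := by
  induction l with
  | zero =>
    refine ⟨φ, Submodule.subset_span ⟨0, translate_zero φ⟩, ?_⟩
    have : cylinder a 0 = Set.univ :=
      Set.eq_univ_of_forall fun x j h0 hj => absurd hj (by push_cast; omega)
    rwa [this, Set.indicator_univ]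
  | succ l ih =>
    obtain ⟨f, hf, hfh⟩ := ih
    have he : unit (-(l : ℤ)) ∈ Lam := fun j hj => by rw [unit_apply, if_neg (by omega)]
    refine ⟨(2⁻¹ : ℂ) • (f + sgn (a (l + 1)) • translate (unit (-(l : ℤ))) f),
      Submodule.smul_mem _ _ (add_mem hf (Submodule.smul_mem _ _ (translate_mem_span he hf))), ?_⟩
    convert (hfh.add ((hfh.translate (unit (-(l : ℤ)))).const_smul (sgn (a (l + 1))))).const_smul
      (2⁻¹ : ℂ) using 1
    ext ω
    have hcyl : ω ∈ cylinder a (l + 1) ↔ ω ∈ cylinder a l ∧ ω (l + 1) = a (l + 1) := by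
      constructor
      · exact fun h => ⟨fun j h0 hj => h j h0 (by push_cast; omega),
          h _ (by omega) (by push_cast; omega)⟩
      · rintro ⟨h1, h2⟩ j h0 hj
        push_cast at hj
        rcases hj.lt_or_eq with h | rfl
        · exact h1 j h0 (by omega)
        · exact h2
    simp only [Pi.smul_apply, Pi.add_apply, smul_eq_mul, chi_unit_left]
    rw [show (1 : ℤ) - -(l : ℤ) = l + 1 by omega]
    by_cases h1 : ω ∈ cylinder a l
    · rw [Set.indicator_of_mem h1]
      rcases zmod_two_cases (ω (l + 1)) with h2 | h2 <;>
        rcases zmod_two_cases (a (l + 1)) with h3 | h3 <;>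
        rw [h2, h3] at hcyl ⊢ <;> simp [Set.indicator, hcyl, h1, sgn_zero, sgn_one] <;> ring
    · rw [Set.indicator_of_notMem h1, Set.indicator_of_notMem fun h => h1 (hcyl.1 h).1]
      simp

/-! ### Periodization -/

instance : Countable Lam := by
  have hfin : ∀ x : Lam, (Function.support fun j => (x : G) j).Finite := by
    intro x
    obtain ⟨N, hN⟩ := exists_mem_U (x : G)
    refine (Set.finite_Icc (-(N : ℤ)) 0).subset fun j hj => ?_
    rw [Function.mem_support] at hj
    refine ⟨?_, ?_⟩ <;> by_contra h
    · exact hj (hN j (by omega))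
    · exact hj (x.2 j (by omega))
  refine Function.Injective.countable (f := fun x : Lam => (hfin x).toFinset) fun x y hxy => ?_
  refine Subtype.ext (G.ext fun j => ?_)
  have : (x : G) j ≠ 0 ↔ (y : G) j ≠ 0 := by
    simpa using (Finset.ext_iff.1 hxy) j
  revert this
  generalize (x : G) j = u, (y : G) j = v
  revert u v; decide

theorem isAddFundamentalDomain_U_zero : IsAddFundamentalDomain Lam (U 0 : Set G) haar := by
  refine IsAddFundamentalDomain.mk' (measurableSet_U 0).nullMeasurableSet fun x => ?_
  obtain ⟨k, hk⟩ := x.2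
  -- The only element of Λ moving x into D is the part of x with indices at most 0, since addition
  -- is modulo 2.
  refine ⟨⟨G.mk (fun j => if j ≤ 0 then x j else 0) ⟨k, fun j hj => ?_⟩, fun j hj => ?_⟩,
    fun j hj => ?_, fun n hn => Subtype.ext (G.ext fun j => ?_)⟩
  · have := hk j hj
    simp only [this, ite_self]
  · exact if_neg (by omega)
  · change (if j ≤ 0 then x j else 0) + x j = 0
    rw [if_pos hj]
    exact CharTwo.add_self_eq_zero _
  · change (n : G) j = if j ≤ 0 then x j else 0
    split_ifs with h
    · have := hn j h
      exact CharTwo.add_eq_zero.1 this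
    · exact n.2 j (by omega)

/-- The `Λ`-periodization of `|g|²`. -/
def periodization (g : G → ℂ) (ω : G) : ℝ≥0∞ := ∑' n : Lam, ‖g (ω + n)‖ₑ ^ 2

theorem aestronglyMeasurable_comp_add {g : G → ℂ} (hg : AEStronglyMeasurable g haar) (n : G) :
    AEStronglyMeasurable (fun ω => g (ω + n)) haar :=
  hg.comp_quasiMeasurePreserving (measurePreserving_add_right haar n).quasiMeasurePreserving

theorem aemeasurable_periodization {g : G → ℂ} (hg : AEStronglyMeasurable g haar) :
    AEMeasurable (periodization g) haar :=
  AEMeasurable.tsum fun n => (aestronglyMeasurable_comp_add hg n).enorm.pow_const 2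

/-- Unfold the integral over the Λ-translates of D; the indicator of S is the same on all of them.
-/
theorem lintegral_mul_periodization {g : G → ℂ} (hg : AEStronglyMeasurable g haar)
    {S : Set G} (hS : MeasurableSet S) (hper : ∀ n ∈ Lam, ∀ ω, ω + n ∈ S ↔ ω ∈ S) :
    ∫⁻ ω in S, ‖g ω‖ₑ ^ 2 ∂haar = ∫⁻ ω in S ∩ U 0, periodization g ω ∂haar := by
  rw [← lintegral_indicator hS, isAddFundamentalDomain_U_zero.lintegral_eq_tsum'',
    ← Measure.restrict_restrict hS]
  unfold periodization
  rw [lintegral_tsum fun n : Lam =>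
    ((aestronglyMeasurable_comp_add hg n).enorm.pow_const 2).restrict.restrict]
  refine tsum_congr fun n => ?_
  rw [← lintegral_indicator hS]
  congr 1
  ext ω
  have e : n +ᵥ ω = ω + n := add_comm _ _
  rw [e]
  by_cases h : ω ∈ S
  · rw [Set.indicator_of_mem h, Set.indicator_of_mem ((hper n n.2 ω).2 h)]
  · rw [Set.indicator_of_notMem h, Set.indicator_of_notMem (mt (hper n n.2 ω).1 h)]

theorem integral_mul_periodization {g : G → ℂ} (hg : MemLp g 2 haar) {q : G → ℂ}
    (hq : Measurable q) (hb : ∀ ω, ‖q ω‖ ≤ 1) (hper : ∀ n ∈ Lam, ∀ ω, q (ω + n) = q ω) :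
    ∫ ω, q ω * ((‖g ω‖ ^ 2 : ℝ) : ℂ) ∂haar =
      ∫ ω in (U 0 : Set G), q ω * ((periodization g ω).toReal : ℂ) ∂haar := by
  have hint : Integrable (fun ω => q ω * ((‖g ω‖ ^ 2 : ℝ) : ℂ)) haar :=
    (hg.integrable_norm_pow two_ne_zero).ofReal.bdd_mul (c := 1) hq.aestronglyMeasurable
      (Eventually.of_forall hb)
  rw [isAddFundamentalDomain_U_zero.integral_eq_tsum'' _ hint]
  have e : ∀ (n : Lam) ω, q (n +ᵥ ω) * ((‖g (n +ᵥ ω)‖ ^ 2 : ℝ) : ℂ) =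
      q ω * ((‖g (ω + n)‖ ^ 2 : ℝ) : ℂ) := by
    intro n ω
    rw [show n +ᵥ ω = ω + n from add_comm _ _, hper n n.2]
  simp_rw [e]
  rw [← integral_tsum]
  · refine integral_congr_ae (Eventually.of_forall fun ω => ?_)
    simp only
    rw [tsum_mul_left, periodization, ENNReal.tsum_toReal_eq (fun n => by simp), Complex.ofReal_tsum]
    simp
  · intro n
    have := aestronglyMeasurable_comp_add hg.1 (n : G)
    exact (hq.aestronglyMeasurable.mul
      (Complex.continuous_ofReal.comp_aestronglyMeasurable (this.norm.pow 2))).restrict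
  · have h1 := isAddFundamentalDomain_U_zero.lintegral_eq_tsum''
      fun ω => ‖q ω * ((‖g ω‖ ^ 2 : ℝ) : ℂ)‖ₑ
    simp_rw [e] at h1
    rw [← h1]
    exact hint.2.ne

/-! ### Frame bounds and the periodization -/

theorem enorm_sq_of_cylinder {f : L2} {g : G → ℂ} {a : G} (ha : a ∈ U 0) {l : ℕ}
    (hg : MemLp g 2 haar) (hf : IsFourierTransform f ((cylinder a l).indicator g)) :
    ‖f‖ₑ ^ 2 = ∫⁻ ω in ball a l, periodization g ω ∂haar := by
  rw [← hf.enorm_toLp, Lp.enorm_toLp, eLpNorm_indicator_eq_eLpNorm_restrict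
    (measurableSet_cylinder a l), eLpNorm_two_sq, lintegral_mul_periodization hg.1
    (measurableSet_cylinder a l) (fun n hn ω => add_mem_cylinder hn), cylinder_inter_U_zero ha]

theorem chi_add_of_Lam {n k ω : G} (hn : n ∈ Lam) (hk : k ∈ Lam) : chi n (ω + k) = chi n ω := by
  rw [chi_add_right, chi_eq_one_of_Lam hn hk, mul_one]

/-- After Parseval the integrand is |g|² times the indicator of the cylinder and χ(n, ·), both
Λ-periodic, so it folds onto D. -/
theorem inner_translate_of_cylinder {φ f : L2} {g : G → ℂ} {a : G} (ha : a ∈ U 0) {l : ℕ}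
    (hφ : IsFourierTransform φ g) (hf : IsFourierTransform f ((cylinder a l).indicator g))
    {n : G} (hn : n ∈ Lam) :
    inner ℂ f (translate n φ) =
      ∫ ω in ball a l, chi n ω * ((periodization g ω).toReal : ℂ) ∂haar := by
  have h := integral_mul_periodization hφ.1 (q := (cylinder a l).indicator (chi n))
    ((continuous_chi_right n).measurable.indicator (measurableSet_cylinder a l))
    (fun ω => (norm_indicator_le_norm_self _ _).trans (norm_chi n ω).le) (fun k hk ω => by
      by_cases h : ω ∈ cylinder a l
      · rw [Set.indicator_of_mem h, Set.indicator_of_mem ((add_mem_cylinder hk).2 h),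
          chi_add_of_Lam hn hk]
      · rw [Set.indicator_of_notMem h, Set.indicator_of_notMem (mt (add_mem_cylinder hk).1 h)])
  have e : ∀ ω, (starRingEnd ℂ) ((cylinder a l).indicator g ω) * (chi n ω * g ω) =
      (cylinder a l).indicator (chi n) ω * ((‖g ω‖ ^ 2 : ℝ) : ℂ) := by
    intro ω
    by_cases h : ω ∈ cylinder a l
    · rw [Set.indicator_of_mem h, Set.indicator_of_mem h, mul_left_comm, Complex.conj_mul']
      push_cast; rfl
    · rw [Set.indicator_of_notMem h, Set.indicator_of_notMem h]; simp
  rw [hf.inner_eq (hφ.translate n)]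
  simp_rw [e]
  rw [h, ← cylinder_inter_U_zero ha, ← Measure.restrict_restrict (measurableSet_cylinder a l),
    ← integral_indicator (measurableSet_cylinder a l)]
  congr 1
  ext ω
  by_cases h : ω ∈ cylinder a l
  · rw [Set.indicator_of_mem h, Set.indicator_of_mem h]
  · rw [Set.indicator_of_notMem h, Set.indicator_of_notMem h, zero_mul]

/-- The Walsh coefficients of the restriction to a ball of the periodization of `|g|²`. -/
def walshCoeff (g : G → ℂ) (a : G) (l : ℕ) (n : Lam) : ℂ :=
  ∫ ω in ball a l, chi n ω * ((periodization g ω).toReal : ℂ) ∂haar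

theorem lintegral_periodization_ne_top {g : G → ℂ} (hg : MemLp g 2 haar) (a : G) (ha : a ∈ U 0)
    (l : ℕ) : ∫⁻ ω in ball a l, periodization g ω ∂haar ≠ ∞ := by
  rw [← cylinder_inter_U_zero ha, ← lintegral_mul_periodization hg.1
    (measurableSet_cylinder a l) (fun n hn ω => add_mem_cylinder hn)]
  refine ((setLIntegral_le_lintegral _ _).trans_lt ?_).ne
  rw [← eLpNorm_two_sq]
  exact ENNReal.pow_lt_top hg.2

/-- These are the frame inequalities for the function whose transform is g cut to the cylinder of a.
-/
theorem walshCoeff_bounds {V : Submodule ℂ L2} {φ : L2} {C D : ℝ} {g : G → ℂ}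
    (hV : IsFrameWithBounds V (fun n : Lam => translate n φ) C D) (hφ : IsFourierTransform φ g)
    {a : G} (ha : a ∈ U 0) (l : ℕ) :
    (Summable fun n => ‖walshCoeff g a l n‖ ^ 2) ∧
    C * (∫⁻ ω in ball a l, periodization g ω ∂haar).toReal ≤ ∑' n, ‖walshCoeff g a l n‖ ^ 2 ∧
    ∑' n, ‖walshCoeff g a l n‖ ^ 2 ≤
      D * (∫⁻ ω in ball a l, periodization g ω ∂haar).toReal := by
  obtain ⟨f, hf, hfh⟩ := exists_isFourierTransform_cylinder hφ a l
  have hfV : f ∈ V := (Submodule.span_le.2 (by rintro _ ⟨n, rfl⟩; exact hV.mem n)) hf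
  have h1 : ‖f‖ ^ 2 = (∫⁻ ω in ball a l, periodization g ω ∂haar).toReal := by
    rw [← enorm_sq_of_cylinder ha hφ.1 hfh]
    simp
  have h2 : ∀ n : Lam, walshCoeff g a l n = inner ℂ f (translate n φ) := fun n =>
    (inner_translate_of_cylinder ha hφ hfh n.2).symm
  simp_rw [h2, ← h1]
  exact ⟨hV.summable f hfV, hV.lower f hfV, hV.upper f hfV⟩

/-- The element of `Λ` whose coordinates with indices `0, -1, …, 1 - l` are given by `c`. -/
def lamOfDigits (l : ℕ) : (Fin l → ZMod 2) ↪ Lam where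
  toFun c := ⟨G.mk (fun j => if h : j ≤ 0 ∧ -(l : ℤ) < j then c ⟨(-j).toNat, by omega⟩ else 0)
    ⟨-l, fun j hj => dif_neg (by omega)⟩, fun j hj => dif_neg (by omega)⟩
  inj' := by
    intro c d hcd
    ext i
    have h : (if h : -(i : ℤ) ≤ 0 ∧ -(l : ℤ) < -(i : ℤ) then c ⟨(-(-(i : ℤ))).toNat, by omega⟩ else 0)
        = if h : -(i : ℤ) ≤ 0 ∧ -(l : ℤ) < -(i : ℤ) then d ⟨(-(-(i : ℤ))).toNat, by omega⟩ else 0 :=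
      congrArg (fun x : Lam => (x : G) (-(i : ℤ))) hcd
    have hi : -(i : ℤ) ≤ 0 ∧ -(l : ℤ) < -(i : ℤ) := by omega
    rw [dif_pos hi, dif_pos hi] at h
    simpa using h

theorem lamOfDigits_mem_U (l : ℕ) (c : Fin l → ZMod 2) : (lamOfDigits l c : G) ∈ U (-(l : ℤ)) :=
  fun j hj => dif_neg (by omega)

theorem norm_walshCoeff_of_mem_U {g : G → ℂ} (hg : MemLp g 2 haar) {a : G} (ha : a ∈ U 0) {l : ℕ}
    {n : Lam} (hn : (n : G) ∈ U (-(l : ℤ))) :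
    ‖walshCoeff g a l n‖ = (∫⁻ ω in ball a l, periodization g ω ∂haar).toReal := by
  rw [walshCoeff, setIntegral_congr_fun (g := fun ω => chi n a * ((periodization g ω).toReal : ℂ))
    (measurableSet_ball a l) fun ω hω => by simp only [chi_eq_chi_of_ball hn hω],
    integral_const_mul, norm_mul, norm_chi, one_mul, integral_complex_ofReal, Complex.norm_real,
    integral_toReal (aemeasurable_periodization hg.1).restrict
      (ae_lt_top' (aemeasurable_periodization hg.1).restrict
        (lintegral_periodization_ne_top hg a ha l))]
  exact abs_of_nonneg ENNReal.toReal_nonneg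

/-- For the 2^l elements n of Λ in U_{-l}, the character is constant on the ball, so each
coefficient has modulus v, the integral of P over the ball. The upper frame bound gives 2^l v² ≤ D
v, hence v ≤ D 2^{-l}. -/
theorem lintegral_periodization_ball_le {V : Submodule ℂ L2} {φ : L2} {C D : ℝ} {g : G → ℂ}
    (hV : IsFrameWithBounds V (fun n : Lam => translate n φ) C D) (hφ : IsFourierTransform φ g)
    {a : G} (ha : a ∈ U 0) (l : ℕ) :
    ∫⁻ ω in ball a l, periodization g ω ∂haar ≤ ENNReal.ofReal D * haar (ball a l) := by
  obtain ⟨hs, -, hu⟩ := walshCoeff_bounds hV hφ ha l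
  have hD : 0 < D := hV.lower_pos.trans_le hV.lower_le_upper
  have hv := lintegral_periodization_ne_top hφ.1 a ha l
  have h1 := hs.sum_le_tsum (Finset.univ.map (lamOfDigits l)) fun n _ => by positivity
  rw [Finset.sum_map, Finset.sum_congr rfl fun c _ => by
    rw [norm_walshCoeff_of_mem_U hφ.1 ha (lamOfDigits_mem_U l c)]] at h1
  rw [haar_ball, haar_U, ← ENNReal.toReal_le_toReal hv
    (ENNReal.mul_ne_top ENNReal.ofReal_ne_top (ENNReal.zpow_ne_top two_ne_zero ENNReal.ofNat_ne_top _)),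
    ENNReal.toReal_mul, ENNReal.toReal_ofReal hD.le, ← haar_U, ← Measure.real, haar_real_U]
  set v := (∫⁻ ω in ball a l, periodization g ω ∂haar).toReal
  have h2 : (2 : ℝ) ^ l * v ^ 2 ≤ D * v := by
    have := h1.trans hu
    simpa using this
  have hv0 : 0 ≤ v := ENNReal.toReal_nonneg
  rw [zpow_neg, zpow_natCast, ← div_eq_mul_inv, le_div_iff₀ (by positivity)]
  rcases hv0.eq_or_lt with h | h
  · rw [← h]; simpa using hD.le
  · nlinarith

theorem periodization_le {V : Submodule ℂ L2} {φ : L2} {C D : ℝ} {g : G → ℂ}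
    (hV : IsFrameWithBounds V (fun n : Lam => translate n φ) C D) (hφ : IsFourierTransform φ g) :
    ∀ᵐ ω ∂haar.restrict (U 0 : Set G), periodization g ω ≤ ENNReal.ofReal D := by
  refine ae_le_of_setLIntegral_ball_le (aemeasurable_periodization hφ.1.1).restrict ?_
    fun b hb k => ?_
  · rw [setLIntegral_const, haar_U_zero, mul_one]
    exact ENNReal.ofReal_ne_top
  · rw [setLIntegral_const]
    exact lintegral_periodization_ball_le hV hφ hb k

open scoped Classical in
theorem integral_U_zero_chi {n : G} (hn : n ∈ Lam) :
    ∫ ω in (U 0 : Set G), chi n ω ∂haar = if n = 0 then 1 else 0 := by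
  have h := setIntegral_chi n 0
  rw [neg_zero] at h
  rw [h]
  by_cases h0 : n = 0
  · rw [if_pos h0, h0, Set.indicator_of_mem (zero_mem (U 0))]
    simp
  · rw [if_neg h0, Set.indicator_of_notMem]
    refine fun h' => h0 (G.ext fun j => ?_)
    rcases le_or_gt j 0 with hj | hj
    · exact h' j hj
    · exact hn j hj

open scoped Classical in
/-- Bessel's inequality for the Walsh functions on `D`. -/
theorem tsum_norm_setIntegral_chi_le {q : G → ℂ} (hq : MemLp q 2 (haar.restrict (U 0 : Set G))) :
    ∑' n : Lam, ‖∫ ω in (U 0 : Set G), chi n ω * q ω ∂haar‖ ^ 2 ≤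
      (∫⁻ ω in (U 0 : Set G), ‖q ω‖ₑ ^ 2 ∂haar).toReal := by
  have hfin : IsFiniteMeasure (haar.restrict (U 0 : Set G)) :=
    ⟨by simpa using (haar_U_ne_top 0).lt_top⟩
  have hχ : ∀ n : Lam, MemLp (chi n) 2 (haar.restrict (U 0 : Set G)) := fun n =>
    MemLp.of_bound (continuous_chi_right n).aestronglyMeasurable 1 (by simp)
  have hinner : ∀ (n : Lam) {k : G → ℂ} (hk : MemLp k 2 (haar.restrict (U 0 : Set G))),
      inner ℂ ((hχ n).toLp _) (hk.toLp _) = ∫ ω in (U 0 : Set G), chi n ω * k ω ∂haar := by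
    intro n k hk
    rw [L2.inner_def]
    refine integral_congr_ae ?_
    filter_upwards [(hχ n).coeFn_toLp, hk.coeFn_toLp] with ω h1 h2
    rw [h1, h2, RCLike.inner_apply', conj_chi]
  have horth : Orthonormal ℂ fun n : Lam => (hχ n).toLp _ := by
    rw [orthonormal_iff_ite]
    intro n k
    rw [hinner n (hχ k)]
    simp_rw [← chi_add_left]
    rw [integral_U_zero_chi (add_mem n.2 k.2), ← sub_eq_add']
    simp only [sub_eq_zero, Subtype.ext_iff]
  have h := horth.tsum_inner_products_le (x := hq.toLp _)
  simp_rw [hinner _ hq] at h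
  refine h.trans (le_of_eq ?_)
  rw [← eLpNorm_two_sq, ENNReal.toReal_pow, Lp.norm_toLp]

/-- The lower frame bound is combined with Bessel's inequality for P restricted to the ball; the
upper bound already proved puts that function in L²(D). -/
theorem le_lintegral_periodization_sq {V : Submodule ℂ L2} {φ : L2} {C D : ℝ} {g : G → ℂ}
    (hV : IsFrameWithBounds V (fun n : Lam => translate n φ) C D) (hφ : IsFourierTransform φ g)
    {a : G} (ha : a ∈ U 0) (l : ℕ) :
    ENNReal.ofReal C * ∫⁻ ω in ball a l, periodization g ω ∂haar ≤
      ∫⁻ ω in ball a l, periodization g ω ^ 2 ∂haar := by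
  have hfin : IsFiniteMeasure (haar.restrict (U 0 : Set G)) :=
    ⟨by simpa using (haar_U_ne_top 0).lt_top⟩
  have hD : 0 < D := hV.lower_pos.trans_le hV.lower_le_upper
  have hle := periodization_le hV hφ
  have hsub : ball a l ⊆ (U 0 : Set G) := by
    rw [← cylinder_inter_U_zero ha]; exact Set.inter_subset_right
  let q : G → ℂ := (ball a l).indicator fun ω => ((periodization g ω).toReal : ℂ)
  have hqm : AEStronglyMeasurable q (haar.restrict (U 0 : Set G)) :=
    (Complex.continuous_ofReal.comp_aestronglyMeasurable
      (aemeasurable_periodization hφ.1.1).ennreal_toReal.aestronglyMeasurable.restrict).indicator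
      (measurableSet_ball a l)
  have hq : MemLp q 2 (haar.restrict (U 0 : Set G)) := by
    refine MemLp.of_bound hqm D ?_
    filter_upwards [hle] with ω hω
    refine (norm_indicator_le_norm_self _ _).trans ?_
    rw [Complex.norm_real, Real.norm_of_nonneg ENNReal.toReal_nonneg]
    exact ENNReal.toReal_le_of_le_ofReal hD.le hω
  have h1 : ∀ n : Lam, walshCoeff g a l n = ∫ ω in (U 0 : Set G), chi n ω * q ω ∂haar := by
    intro n
    rw [walshCoeff, ← Set.inter_eq_left.2 hsub, ← Measure.restrict_restrict (measurableSet_ball a l),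
      ← integral_indicator (measurableSet_ball a l)]
    congr 1
    ext ω
    simp only [q, Set.indicator_mul_right]
  have h2 : ∫⁻ ω in (U 0 : Set G), ‖q ω‖ₑ ^ 2 ∂haar =
      ∫⁻ ω in ball a l, periodization g ω ^ 2 ∂haar := by
    rw [← Set.inter_eq_left.2 hsub, ← Measure.restrict_restrict (measurableSet_ball a l),
      ← lintegral_indicator (measurableSet_ball a l)]
    refine lintegral_congr_ae ?_
    filter_upwards [hle] with ω hω
    by_cases h : ω ∈ ball a l
    · simp only [q]
      rw [Set.indicator_of_mem h, Set.indicator_of_mem h, ← ofReal_norm, Complex.norm_real,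
        Real.norm_of_nonneg ENNReal.toReal_nonneg,
        ENNReal.ofReal_toReal (hω.trans_lt ENNReal.ofReal_lt_top).ne]
    · simp only [q]
      rw [Set.indicator_of_notMem h, Set.indicator_of_notMem h]; simp
  have hne : ∫⁻ ω in ball a l, periodization g ω ^ 2 ∂haar ≠ ∞ := by
    rw [← h2, ← eLpNorm_two_sq]
    exact (ENNReal.pow_lt_top hq.2).ne
  have h3 := (walshCoeff_bounds hV hφ ha l).2.1
  simp_rw [h1] at h3
  have h4 := h3.trans (tsum_norm_setIntegral_chi_le hq)
  rw [h2] at h4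
  rw [← ENNReal.toReal_le_toReal (ENNReal.mul_ne_top ENNReal.ofReal_ne_top
    (lintegral_periodization_ne_top hφ.1 a ha l)) hne, ENNReal.toReal_mul,
    ENNReal.toReal_ofReal hV.lower_pos.le]
  exact h4

/-- The ball inequalities give C P ≤ P² almost everywhere on D, and P, being finite there, can be
cancelled where it is nonzero. -/
theorem le_periodization {V : Submodule ℂ L2} {φ : L2} {C D : ℝ} {g : G → ℂ}
    (hV : IsFrameWithBounds V (fun n : Lam => translate n φ) C D) (hφ : IsFourierTransform φ g) :
    ∀ᵐ ω ∂haar.restrict (U 0 : Set G), periodization g ω ≠ 0 →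
      ENNReal.ofReal C ≤ periodization g ω := by
  have hle := periodization_le hV hφ
  have hm := aemeasurable_periodization hφ.1.1
  have key := ae_le_of_setLIntegral_ball_le (f := fun ω => ENNReal.ofReal C * periodization g ω)
    (g := fun ω => periodization g ω ^ 2) (hm.const_mul _).restrict ?_ fun b hb k => ?_
  · filter_upwards [key, hle] with ω h1 h2 h0
    rw [sq] at h1
    exact (ENNReal.mul_le_mul_iff_left h0 (h2.trans_lt ENNReal.ofReal_lt_top).ne).1 h1
  · refine ((lintegral_mono_ae (g := fun _ => ENNReal.ofReal D ^ 2) ?_).trans_lt ?_).ne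
    · filter_upwards [hle] with ω hω
      gcongr
    · rw [setLIntegral_const, haar_U_zero, mul_one]
      exact ENNReal.pow_lt_top ENNReal.ofReal_lt_top
  · rw [lintegral_const_mul'' _ hm.restrict]
    exact le_lintegral_periodization_sq hV hφ hb k

/-! ### The refinement equation -/

/-- The image of Haar measure under an automorphism is again a Haar measure, so null sets pull back
to null sets; the scaling factor is irrelevant. -/
theorem quasiMeasurePreserving_sigma : Measure.QuasiMeasurePreserving sigma haar haar := by
  refine ⟨continuous_sigma.measurable, ?_⟩
  have : (Measure.map sigma haar).IsAddHaarMeasure :=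
    sigma.isAddHaarMeasure_map haar continuous_sigma continuous_rho
  exact Measure.absolutelyContinuous_isAddHaarMeasure _ _

theorem sigma_mem_Lam_of_Lam1 {n : G} (hn : n ∈ Lam1) : sigma n ∈ Lam := by
  obtain ⟨k, hk, rfl⟩ := hn
  have : sigma (rho k) = k := rho.symm_apply_apply k
  exact this.symm ▸ hk

theorem mem_Lam1_iff {n : G} : n ∈ Lam1 ↔ n ∈ Lam ∧ n 0 = 0 := by
  constructor
  · rintro ⟨k, hk, rfl⟩
    exact ⟨fun j hj => hk _ (by omega), hk _ (by omega)⟩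
  · rintro ⟨h1, h2⟩
    refine ⟨sigma n, fun j hj => ?_, rho.apply_symm_apply n⟩
    rw [sigma_apply]
    rcases eq_or_ne j 1 with rfl | h
    · exact h2
    · exact h1 _ (by omega)

theorem rho_sigma (x : G) : rho (sigma x) = x := rho.apply_symm_apply x

theorem sigma_rho (x : G) : sigma (rho x) = x := rho.symm_apply_apply x

/-- `ρ` as a bijection from `Λ` onto `Λ₁`. -/
def lamEquivLam1 : Lam ≃ ((Lam1 : Set G) : Type) where
  toFun n := ⟨rho n, ⟨n, n.2, rfl⟩⟩
  invFun k := ⟨sigma k, sigma_mem_Lam_of_Lam1 k.2⟩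
  left_inv n := Subtype.ext (sigma_rho n)
  right_inv k := Subtype.ext (rho_sigma k)

theorem sigma_add_pointOne_mem_Lam {n : G} (hn : n ∈ Lam) (h : n ∉ Lam1) :
    sigma n + pointOne ∈ Lam := by
  intro j hj
  rw [add_apply, sigma_apply, pointOne_eq, unit_apply]
  split_ifs with h1
  · subst h1
    have : n 0 ≠ 0 := fun h0 => h (mem_Lam1_iff.2 ⟨hn, h0⟩)
    rw [sub_self, (zmod_two_cases _).resolve_left this]
    exact CharTwo.add_self_eq_zero _
  · rw [hn _ (by omega), add_zero]

theorem rho_add_pointOne_mem {n : G} (hn : n ∈ Lam) :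
    rho (n + pointOne) ∈ (Lam : Set G) \ (Lam1 : Set G) := by
  constructor
  · intro j hj
    rw [rho_apply, add_apply, pointOne_eq, unit_apply, if_neg (by omega), add_zero]
    exact hn _ (by omega)
  · intro h
    have := (mem_Lam1_iff.1 h).2
    rw [rho_apply, add_apply, pointOne_eq, unit_apply, if_pos (by omega), hn _ (by omega),
      zero_add] at this
    exact one_ne_zero this

/-- The bijection `n ↦ ρ(n + 0.1)` from `Λ` onto `Λ ∖ Λ₁`. -/
def lamEquivDiff : Lam ≃ (((Lam : Set G) \ (Lam1 : Set G) : Set G) : Type) where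
  toFun n := ⟨rho (n + pointOne), rho_add_pointOne_mem n.2⟩
  invFun k := ⟨sigma k + pointOne, sigma_add_pointOne_mem_Lam k.2.1 k.2.2⟩
  left_inv n := by
    refine Subtype.ext ?_
    change sigma (rho (n + pointOne)) + pointOne = n
    rw [sigma_rho, add_assoc, add_self', add_zero]
  right_inv k := by
    refine Subtype.ext ?_
    change rho (sigma k + pointOne + pointOne) = k
    rw [add_assoc, add_self', add_zero, rho_sigma]

/-- With `tsum_diff`, this turns the two conditions defining Δ₂ into P(σω) ≠ 0 and P(σω + 0.1) ≠ 0.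
-/
theorem tsum_Lam1 (g : G → ℂ) (ω : G) :
    (∑' n : ((Lam1 : Set G) : Type), ‖g (sigma (ω + n))‖ₑ ^ 2) = periodization g (sigma ω) := by
  rw [← lamEquivLam1.tsum_eq]
  refine tsum_congr fun n => ?_
  rw [map_add]
  change ‖g (sigma ω + sigma (rho n))‖ₑ ^ 2 = _
  rw [sigma_rho]

theorem tsum_diff (g : G → ℂ) (ω : G) :
    (∑' n : (((Lam : Set G) \ (Lam1 : Set G) : Set G) : Type), ‖g (sigma (ω + n))‖ₑ ^ 2) =
      periodization g (sigma ω + pointOne) := by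
  rw [← lamEquivDiff.tsum_eq]
  refine tsum_congr fun n => ?_
  rw [map_add]
  change ‖g (sigma ω + sigma (rho (n + pointOne)))‖ₑ ^ 2 = _
  rw [sigma_rho, ← add_assoc, add_right_comm]

theorem periodization_eq_add (g : G → ℂ) (ω : G) :
    periodization g ω = (∑' n : ((Lam1 : Set G) : Type), ‖g (ω + n)‖ₑ ^ 2) +
      ∑' n : (((Lam : Set G) \ (Lam1 : Set G) : Set G) : Type), ‖g (ω + n)‖ₑ ^ 2 := by
  have hsub : (Lam1 : Set G) ⊆ Lam := fun n hn => (mem_Lam1_iff.1 hn).1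
  have h := ENNReal.summable.tsum_union_disjoint (f := fun n => ‖g (ω + n)‖ₑ ^ 2)
    (s := (Lam1 : Set G)) (t := (Lam : Set G) \ Lam1) Set.disjoint_sdiff_right ENNReal.summable
  rw [Set.union_sdiff_cancel hsub] at h
  exact h

/-- Write φ̂(ω+n) = m(σω+σn) φ̂(σω+σn). Modulo Λ, σn is 0 for n in Λ₁ and 0.1 otherwise, so
periodicity pulls m out of each half of the sum. -/
theorem periodization_refinement {φhat m : G → ℂ} (hm : IsMask φhat m) :
    ∀ᵐ ω ∂haar, periodization φhat ω =
      ‖m (sigma ω)‖ₑ ^ 2 * periodization φhat (sigma ω) +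
      ‖m (sigma ω + pointOne)‖ₑ ^ 2 * periodization φhat (sigma ω + pointOne) := by
  have h1 : ∀ᵐ ω ∂haar, ∀ n : Lam, φhat (ω + n) = m (sigma (ω + n)) * φhat (sigma (ω + n)) := by
    rw [ae_all_iff]
    intro n
    have := (quasiMeasurePreserving_sigma.comp
      (measurePreserving_add_right haar (n : G)).quasiMeasurePreserving).ae hm.refinement
    filter_upwards [this] with ω hω
    rw [Function.comp_apply, rho_sigma] at hω
    exact hω
  have h2 : ∀ᵐ ω ∂haar, ∀ n : Lam, m (ω + n) = m ω :=
    ae_all_iff.2 fun n => hm.periodic n n.2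
  have h3 := quasiMeasurePreserving_sigma.ae h2
  have h4 := ((measurePreserving_add_right haar pointOne).quasiMeasurePreserving.comp
    quasiMeasurePreserving_sigma).ae h2
  filter_upwards [h1, h3, h4] with ω h1 h3 h4
  rw [periodization_eq_add, ← tsum_Lam1, ← tsum_diff, ← ENNReal.tsum_mul_left,
    ← ENNReal.tsum_mul_left]
  congr 1
  · refine tsum_congr fun n => ?_
    have hn : (n : G) ∈ Lam := (mem_Lam1_iff.1 n.2).1
    rw [h1 ⟨n, hn⟩, enorm_mul, mul_pow]
    congr 3
    rw [map_add]
    exact h3 ⟨sigma n, sigma_mem_Lam_of_Lam1 n.2⟩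
  · refine tsum_congr fun n => ?_
    rw [h1 ⟨n, n.2.1⟩, enorm_mul, mul_pow]
    congr 3
    rw [map_add]
    have := h4 ⟨sigma n + pointOne, sigma_add_pointOne_mem_Lam n.2.1 n.2.2⟩
    rw [Function.comp_apply] at this
    rw [← this]
    congr 1
    change _ = sigma ω + pointOne + (sigma n + pointOne)
    -- The two copies of 0.1 cancel.
    rw [add_add_add_comm, add_comm pointOne, add_right_comm, ← add_assoc, add_assoc _ _ pointOne]
    simp [add_self']

/-- An elementary estimate behind the bounds for the mask. -/
theorem mask_bounds {C D x y s t p : ℝ} (hC : 0 < C) (hCD : C ≤ D) (hx : 0 ≤ x) (hy : 0 ≤ y)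
    (hxy : 0 < x + y) (hs : C ≤ s) (hs' : s ≤ D) (ht : C ≤ t) (ht' : t ≤ D)
    (hp : p = x * s + y * t) (hpC : p ≠ 0 → C ≤ p) (hpD : p ≤ D) :
    C / D ≤ x + y ∧ x + y ≤ D / C := by
  have hD : 0 < D := hC.trans_le hCD
  have h1 : C * (x + y) ≤ p := by nlinarith
  have h2 : p ≤ D * (x + y) := by nlinarith
  have h3 : 0 < p := lt_of_lt_of_le (by positivity) h1
  rw [div_le_iff₀ hD, le_div_iff₀ hC]
  exact ⟨by linarith [hpC h3.ne'], by linarith⟩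

end CantorDyadic

end

/-! ### The bounds for the mask on Δ₂ -/

theorem mainTheorem8
    (V : ℤ → Submodule ℂ CantorDyadic.L2) (φ : CantorDyadic.L2) (C D : ℝ)
    (hV : CantorDyadic.IsFMRA V φ C D)
    (φhat : CantorDyadic.G → ℂ) (hφhat : CantorDyadic.IsFourierTransform φ φhat)
    (m : CantorDyadic.G → ℂ) (hm : CantorDyadic.IsMask φhat m)
    (hE : CantorDyadic.haar (CantorDyadic.exceptionalSet φhat m) = 0) :
    ∀ᵐ ω ∂CantorDyadic.haar, ω ∈ CantorDyadic.Delta2 φhat →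
      C / D ≤ ‖m (CantorDyadic.sigma ω)‖ ^ 2
          + ‖m (CantorDyadic.sigma ω + CantorDyadic.pointOne)‖ ^ 2 ∧
      ‖m (CantorDyadic.sigma ω)‖ ^ 2
          + ‖m (CantorDyadic.sigma ω + CantorDyadic.pointOne)‖ ^ 2 ≤ D / C := by
  open CantorDyadic in
  have hC : 0 < C := hV.frame.lower_pos
  have hD : 0 < D := hC.trans_le hV.frame.lower_le_upper
  have hb : ∀ᵐ ω ∂haar, ω ∈ U 0 → periodization φhat ω ≤ ENNReal.ofReal D ∧
      (periodization φhat ω ≠ 0 → ENNReal.ofReal C ≤ periodization φhat ω) := by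
    refine (ae_restrict_iff' (measurableSet_U 0)).1 ?_
    filter_upwards [periodization_le hV.frame hφhat, le_periodization hV.frame hφhat] with ω h1 h2
    exact ⟨h1, h2⟩
  -- The bounds on P hold only almost everywhere, so they are pulled back along ω ↦ σω and ω ↦ σω +
  -- 0.1, both of which map D into D.
  have hbσ := quasiMeasurePreserving_sigma.ae hb
  have hbσ' := ((measurePreserving_add_right haar pointOne).quasiMeasurePreserving.comp
    quasiMeasurePreserving_sigma).ae hb
  have hE' : ∀ᵐ ω ∂haar, ω ∉ exceptionalSet φhat m := measure_eq_zero_iff_ae_notMem.1 hE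
  filter_upwards [hb, hbσ, hbσ', hE', periodization_refinement hm] with ω h1 h2 h3 h4 h5 hω
  obtain ⟨hω0, hω1, hω2⟩ := id hω
  rw [tsum_Lam1] at hω1
  rw [tsum_diff] at hω2
  have hσ : sigma ω ∈ U 0 := fun j hj => hω0 _ (by omega)
  have hσ' : sigma ω + pointOne ∈ U 0 :=
    add_mem hσ fun j hj => by rw [pointOne_eq, unit_apply, if_neg (by omega)]
  have bound : ∀ {x : ℝ≥0∞}, x ≤ ENNReal.ofReal D → x.toReal ≤ D := fun hx =>
    ENNReal.toReal_le_of_le_ofReal hD.le hx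
  have bound' : ∀ {x : ℝ≥0∞}, x ≤ ENNReal.ofReal D → ENNReal.ofReal C ≤ x → C ≤ x.toReal :=
    fun hx hx' => (ENNReal.ofReal_le_iff_le_toReal (hx.trans_lt ENNReal.ofReal_lt_top).ne).1 hx'
  obtain ⟨p1, p2⟩ := h1 hω0
  obtain ⟨s1, s2⟩ := h2 hσ
  obtain ⟨t1, t2⟩ := h3 hσ'
  simp only [Function.comp_apply] at t1 t2
  have ht : ∀ {x : ℝ≥0∞}, x ≤ ENNReal.ofReal D → x ≠ ∞ := fun hx =>
    (hx.trans_lt ENNReal.ofReal_lt_top).ne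
  refine mask_bounds hC hV.frame.lower_le_upper (sq_nonneg _) (sq_nonneg _) ?_
    (bound' s1 (s2 hω1)) (bound s1) (bound' t1 (t2 hω2)) (bound t1)
    (p := (periodization φhat ω).toReal) ?_ (fun h => bound' p1 (p2 fun h' => h (by simp [h'])))
    (bound p1)
  -- If the sum of the two squares were not positive, both values of m would vanish and ω would lie
  -- in the null set E.
  · by_contra hneg
    refine h4 ⟨hω, ?_, ?_⟩ <;> rw [← norm_eq_zero, ← sq_eq_zero_iff (a := ‖_‖)] <;>
      nlinarith [sq_nonneg ‖m (sigma ω)‖, sq_nonneg ‖m (sigma ω + pointOne)‖]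
  · rw [h5, ENNReal.toReal_add (ENNReal.mul_ne_top (by simp) (ht s1))
      (ENNReal.mul_ne_top (by simp) (ht t1)), ENNReal.toReal_mul, ENNReal.toReal_mul]
    simp
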